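/- Let $m\ge 0$, let $C_1,\dots,C_m,B,R$ be finite-dimensional quantum systems, and let $|\psi\rangle^{C_1\cdots C_mBR}$ be a pure state shared by $m$ senders $C_1,\dots,C_m$ and a receiver $B$, with purifying (reference) system $R$. Let $K_1,\dots,K_m,L_1,\dots,L_m$ be positive integers and let $\epsilon>0$. All logarithms are to base $2$. For a nonempty subset $\mathcal T\subseteq\{1,\dots,m\}$ let $\psi^{\mathcal TR}$ denote the reduced state of $\psi$ on $\bigotimes_{i\in\mathcal T}C_i\otimes R$, and let $H_{\min}(\psi^{\mathcal TR}|\psi^R):=-\log\lambda$, where $\lambda$ is the least positive number such that $\lambda\,(I^{\mathcal T}\otimes\psi^R)-\psi^{\mathcal TR}$ is positive semidefinite. A simultaneous-measurement merging protocol with parameters $(K_i),(L_i)$ acts as follows. Sender $i$ holds $C_i$ and an ancilla $C_i^0$ of dimension $K_i$, and the receiver holds $B$ and ancillas $B_i^0$ of dimension $K_i$; each pair $C_i^0B_i^0$ is initially in the maximally entangled state $\Phi^{K_i}$. All senders simultaneously apply quantum instruments $\{\mathcal E^i_{j}\}_{j}$ to their own shares, sender $i$'s mapping $C_iC_i^0$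 to a system $C_i^1$ of dimension $L_i$, and send their outcomes $J=(j_1,\dots,j_m)$ to the receiver, who then applies a channel (completely positive trace-preserving map) $\mathcal D_J: BB_1^0\cdots B_m^0\to B_1^1\cdots B_m^1\,B_M\,B$, where $\dim B_i^1=L_i$ and $B_M$ is a copy of $C_1\cdots C_m$. The LOCC channel so implemented is $\Lambda=\sum_J\big(\mathcal E^1_{j_1}\otimes\cdots\otimes\mathcal E^m_{j_m}\big)\otimes\mathcal D_J$. It merges $\psi$ with error $\epsilon$ and entanglement cost $(\log K_1-\log L_1,\dots,\log K_m-\log L_m)$ if $$\Big\|(\mathrm{id}_R\otimes\Lambda)\big(\psi^{C_1\cdots C_mBR}\otimes\textstyle\bigotimes_i\Phi^{K_i}\big)-\psi^{B_MBR}\otimes\bigotimes_i\Phi^{L_i}\Big\|_1\le\epsilon ,$$ where $\Phi^{L_i}$ is the maximally entangled state on $C_i^1B_i^1$, $\psi^{B_MBR}$ is $\psi$ with $B_M$ in the place of $C_1\cdots C_m$, and $\|X\|_1=\mathrm{Tr}\sqrt{X^\dagger X}$. **Theorem.** If, for every nonempty subset $\mathcal T\subseteq\{1,\dots,m\}$,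 $$\sum_{i\in\mathcal T}\log\frac{K_i}{L_i}\;\ge\;-H_{\min}(\psi^{\mathcal TR}|\psi^R)+4\log\frac1\epsilon+2m+8,$$ then there exists a simultaneous-measurement merging protocol with parameters $(K_i),(L_i)$ that merges $\psi$ with error $\epsilon$. -/

import Mathlib

/-
Finite-dimensional systems are given by finite index types: the system with index type `a` is the
Hilbert space with orthonormal basis `a`, operators from `a` to `b` are matrices `Matrix b a ℂ`,
and composite systems have product (or dependent function) index types.
-/
open scoped Kronecker ComplexOrder

namespace MultipartyMerging

noncomputable section

/-- The rank-one operator `|v⟩⟨v|`. -/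
def pureState {a : Type*} (v : a → ℂ) : Matrix a a ℂ :=
  Matrix.vecMulVec v (star v)

open Classical in
/-- Trace norm `‖X‖₁ = Tr √(Xᴴ X)`, the sum of the square roots of the eigenvalues of `Xᴴ X`. -/
def traceNorm {a : Type*} [Fintype a] (X : Matrix a a ℂ) : ℝ :=
  ∑ i, √((Matrix.isHermitian_conjTranspose_mul_self X).eigenvalues i)

/-- Partial trace over the first tensor factor. -/
def traceFst {a b : Type*} [Fintype a] (ρ : Matrix (a × b) (a × b) ℂ) : Matrix b b ℂ :=
  Matrix.of fun x y => ∑ k, ρ (k, x) (k, y)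

/-- Min-entropy `H_min(ρ^{AR}|σ^R) = -log₂ λ`, with `λ` the least positive number such that
`λ (I^A ⊗ σ^R) - ρ^{AR}` is positive semidefinite. Such numbers exist whenever the support of
`ρ^R` lies in the support of `σ^R`, in particular for `σ^R = ρ^R`, where `λ = d_A` is one. -/
def minEntropy {a r : Type*} [Fintype a] [DecidableEq a] [Fintype r]
    (ρ : Matrix (a × r) (a × r) ℂ) (σ : Matrix r r ℂ) : ℝ :=
  -Real.logb 2 (sInf {l : ℝ | 0 < l ∧ (l • ((1 : Matrix a a ℂ) ⊗ₖ σ) - ρ).PosSemidef})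

/-- Amplitudes of the maximally entangled state `|Φ^K⟩ = K^{-1/2} ∑ₓ |x⟩|x⟩`. -/
def maxEnt (K : ℕ) (x y : Fin K) : ℂ :=
  if x = y then ((1 / √(K : ℝ) : ℝ) : ℂ) else 0

/-- A quantum instrument with finitely many outcomes, from system `a` to system `b`, in
operator-sum form: the component of outcome `j` is the completely positive map
`ρ ↦ ∑ₖ kraus j k * ρ * (kraus j k)ᴴ`, and the components sum to a trace-preserving map. -/
structure Instrument (a b : Type*) [Fintype a] [DecidableEq a] [Fintype b] where
  outcomes : ℕ
  krausNum : ℕ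
  kraus : Fin outcomes → Fin krausNum → Matrix b a ℂ
  complete : ∑ j, ∑ k, (kraus j k).conjTranspose * kraus j k = 1

/-- A quantum channel (completely positive trace-preserving map) from system `a` to system `b`,
in operator-sum form. -/
structure Channel (a b : Type*) [Fintype a] [DecidableEq a] [Fintype b] where
  krausNum : ℕ
  kraus : Fin krausNum → Matrix b a ℂ
  complete : ∑ k, (kraus k).conjTranspose * kraus k = 1

/-- The tensor product `A₁ ⊗ ⋯ ⊗ A_m` of operators. -/
def tensorPi {m : ℕ} {a b : Fin m → Type*} (A : ∀ i, Matrix (b i) (a i) ℂ) :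
    Matrix (∀ i, b i) (∀ i, a i) ℂ :=
  Matrix.of fun x y => ∏ i, A i (x i) (y i)

section State

variable {m : ℕ} {C : Fin m → Type*} {B R : Type*}
  [∀ i, Fintype (C i)] [Fintype B]

/-- The reduced state on `𝒯 R` of a state on `C₁ ⋯ C_m B R`, for a set `𝒯` of senders: the
senders outside `𝒯` and `B` are traced out. -/
def reducedTR (ρ : Matrix ((∀ i, C i) × B × R) ((∀ i, C i) × B × R) ℂ) (T : Finset (Fin m)) :
    Matrix ((∀ i : {i // i ∈ T}, C i) × R) ((∀ i : {i // i ∈ T}, C i) × R) ℂ :=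
  traceFst (a := (∀ i : {i // i ∉ T}, C i) × B) (ρ.submatrix
    (fun x => ((Equiv.piEquivPiSubtypeProd (· ∈ T) C).symm (x.2.1, x.1.1), x.1.2, x.2.2))
    (fun x => ((Equiv.piEquivPiSubtypeProd (· ∈ T) C).symm (x.2.1, x.1.1), x.1.2, x.2.2)))

/-- The reduced state on `R` of a state on `C₁ ⋯ C_m B R`. -/
def reducedR (ρ : Matrix ((∀ i, C i) × B × R) ((∀ i, C i) × B × R) ℂ) : Matrix R R ℂ :=
  traceFst (traceFst ρ)

end State

section Protocol

variable {m : ℕ} (C : Fin m → Type*) (B : Type*) (K L : Fin m → ℕ)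

/-- The systems `C_i C⁰_i` of all senders before the protocol, `dim C⁰_i = K_i`. -/
abbrev SenderIn : Type _ := ∀ i, C i × Fin (K i)

/-- The systems `B B⁰_M` of the receiver before the protocol, `dim B⁰_i = K_i`. -/
abbrev ReceiverIn : Type _ := B × (∀ i, Fin (K i))

/-- The systems `C¹_M` of all senders after the protocol, `dim C¹_i = L_i`. -/
abbrev SenderOut : Type := ∀ i, Fin (L i)

/-- The systems `B¹_M B_M B` of the receiver after the protocol, where `dim B¹_i = L_i` and `B_M`
is a copy of `C_M`. -/
abbrev ReceiverOut : Type _ := (∀ i, Fin (L i)) × (∀ i, C i) × B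

variable [∀ i, Fintype (C i)] [∀ i, DecidableEq (C i)] [Fintype B] [DecidableEq B]

/-- A protocol with simultaneous measurements: every sender `i` applies an instrument
`C_i C⁰_i → C¹_i` to his own share and announces the outcome `j_i`; knowing
`J = (j_1, …, j_m)`, the receiver applies a channel `B B⁰_M → B¹_M B_M B`. -/
structure Protocol where
  sender : ∀ i, Instrument (C i × Fin (K i)) (Fin (L i))
  decoder : (∀ i, Fin (sender i).outcomes) → Channel (ReceiverIn B K) (ReceiverOut C B L)

variable {C B K L}

/-- The Kraus operators of the channel `Λ` implemented by the protocol. -/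
def Protocol.kraus (P : Protocol C B K L) (J : ∀ i, Fin (P.sender i).outcomes)
    (k : ∀ i, Fin (P.sender i).krausNum) (l : Fin (P.decoder J).krausNum) :
    Matrix (SenderOut L × ReceiverOut C B L) (SenderIn C K × ReceiverIn B K) ℂ :=
  tensorPi (fun i => (P.sender i).kraus (J i) (k i)) ⊗ₖ (P.decoder J).kraus l

/-- `(Λ ⊗ id_R)(ρ)` for the channel `Λ` implemented by the protocol. -/
def Protocol.apply {R : Type*} [Fintype R] [DecidableEq R] (P : Protocol C B K L)
    (ρ : Matrix ((SenderIn C K × ReceiverIn B K) × R) ((SenderIn C K × ReceiverIn B K) × R) ℂ) :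
    Matrix ((SenderOut L × ReceiverOut C B L) × R) ((SenderOut L × ReceiverOut C B L) × R) ℂ :=
  ∑ J, ∑ k, ∑ l, (P.kraus J k l ⊗ₖ (1 : Matrix R R ℂ)) * ρ *
    (P.kraus J k l ⊗ₖ (1 : Matrix R R ℂ)).conjTranspose

/-- The initial state `|ψ⟩^{C_M B R} ⊗ |Φ^{K_1}⟩ ⊗ ⋯ ⊗ |Φ^{K_m}⟩`. -/
def initialVec {R : Type*} (K : Fin m → ℕ) (ψ : (∀ i, C i) × B × R → ℂ) :
    (SenderIn C K × ReceiverIn B K) × R → ℂ :=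
  fun x => ψ (fun i => (x.1.1 i).1, x.1.2.1, x.2) *
    ∏ i, maxEnt (K i) (x.1.1 i).2 (x.1.2.2 i)

/-- The target state `|ψ⟩^{B_M B R} ⊗ |Φ^{L_1}⟩ ⊗ ⋯ ⊗ |Φ^{L_m}⟩`, with `B_M` in the place of
`C_M`. -/
def targetVec {R : Type*} (L : Fin m → ℕ) (ψ : (∀ i, C i) × B × R → ℂ) :
    (SenderOut L × ReceiverOut C B L) × R → ℂ :=
  fun x => ψ (x.1.2.2.1, x.1.2.2.2, x.2) * ∏ i, maxEnt (L i) (x.1.1 i) (x.1.2.1 i)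

/-- The protocol merges `ψ` with error `ε`:
`‖(Λ ⊗ id_R)(ψ^{C_M B R} ⊗ Φ^{K_M}) - ψ^{B_M B R} ⊗ Φ^{L_M}‖₁ ≤ ε`. -/
def Protocol.Merges {R : Type*} [Fintype R] [DecidableEq R] (P : Protocol C B K L)
    (ψ : (∀ i, C i) × B × R → ℂ) (ε : ℝ) : Prop :=
  traceNorm (P.apply (pureState (initialVec K ψ)) - pureState (targetVec L ψ)) ≤ ε

end Protocol

end

end MultipartyMerging

/-! Each sender measures with one Kraus operator for every matrix whose entries lie in the
eight-point set `sample` (`sampleKraus`). Averaging over random codes is therefore averaging over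
the measurement outcomes themselves, and no good instrument has to be selected afterwards.

After outcome ω the state is pure, with matrix `outcomeMat ω ψ` from the receiver to C¹R. The
target's reduced state on C¹R is a multiple of I ⊗ ψ^R (`targetMat_mul_conjTranspose`). If the
outcome's reduced state is close to it, the receiver can carry one purification near the other:
`exists_contraction_overlap` combines Uhlmann's argument with a Powers–Størmer inequality,
`exists_kraus_completion` extends the resulting contraction to a channel, and `traceNorm_sum_le`
turns the overlaps into a trace distance.

Closeness is a second-moment computation. The entries obey Wick's rule up to the order needed, so
every sender contributes two pairings, of weights L²K (sender kept) and LK² (sender traced out).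
Expanding the product over senders gives one term per subset 𝒯, weighted by the purity on 𝒯R
(`sum_transfer_mul_star`). The empty subset is the squared mean and cancels
(`sum_hsSq_outcomeMat_sub`).

Passing from Hilbert–Schmidt to trace norm should not cost the dimension of R. So write ψ = (I ⊗ s)χ
with s⁴ = ψ^R: the weighted Cauchy–Schwarz inequality `re_trace_mul_sandwich_le` costs only Tr(I ⊗
s⁴) = ∏ L_i, and `exists_whitening` bounds the purity of χ^{𝒯R} by every λ admissible in the
min-entropy. The error is then three times the fourth root of the sum over nonempty 𝒯 of ∏_{𝒯}
(L_i/K_i) · 2^{-H_min} (`exists_protocol`), and the cost condition makes each term at most (ε/4)⁴ /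
2^m. -/

namespace MultipartyMerging

open Matrix

/-! ### Functional calculus of Hermitian matrices. -/

section SpectralMap

variable {n : Type*} [Fintype n] [DecidableEq n] {A : Matrix n n ℂ}

/-- The functional calculus `f(A)` of a Hermitian matrix. -/
noncomputable def spectralMap (hA : A.IsHermitian) (f : ℝ → ℝ) : Matrix n n ℂ :=
  (hA.eigenvectorUnitary : Matrix n n ℂ) * diagonal (fun i => ((f (hA.eigenvalues i) : ℝ) : ℂ)) *
    (hA.eigenvectorUnitary : Matrix n n ℂ)ᴴ

theorem spectralMap_id (hA : A.IsHermitian) : spectralMap hA (fun x => x) = A := by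
  conv_rhs => rw [hA.spectral_theorem, Unitary.conjStarAlgAut_apply]
  rfl

theorem spectralMap_mul (hA : A.IsHermitian) (f g : ℝ → ℝ) :
    spectralMap hA f * spectralMap hA g = spectralMap hA (fun x => f x * g x) := by
  have h : (hA.eigenvectorUnitary : Matrix n n ℂ)ᴴ * (hA.eigenvectorUnitary : Matrix n n ℂ) = 1 :=
    Unitary.coe_star_mul_self _
  unfold spectralMap
  simp only [Matrix.mul_assoc]
  rw [← Matrix.mul_assoc _ (hA.eigenvectorUnitary : Matrix n n ℂ), h, Matrix.one_mul,
    ← Matrix.mul_assoc (diagonal _) (diagonal _), diagonal_mul_diagonal]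
  simp

theorem spectralMap_one (hA : A.IsHermitian) : spectralMap hA (fun _ => 1) = 1 := by
  have h : (hA.eigenvectorUnitary : Matrix n n ℂ) * (hA.eigenvectorUnitary : Matrix n n ℂ)ᴴ = 1 :=
    Unitary.coe_mul_star_self _
  simp [spectralMap, h]

theorem spectralMap_isHermitian (hA : A.IsHermitian) (f : ℝ → ℝ) :
    (spectralMap hA f).IsHermitian := by
  unfold Matrix.IsHermitian spectralMap
  simp only [conjTranspose_mul, conjTranspose_conjTranspose, diagonal_conjTranspose,
    Matrix.mul_assoc]
  congr 3
  ext i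
  simp

theorem spectralMap_add (hA : A.IsHermitian) (f g : ℝ → ℝ) :
    spectralMap hA f + spectralMap hA g = spectralMap hA (fun x => f x + g x) := by
  unfold spectralMap
  rw [← Matrix.add_mul, ← Matrix.mul_add, diagonal_add]
  simp

theorem spectralMap_sub (hA : A.IsHermitian) (f g : ℝ → ℝ) :
    spectralMap hA f - spectralMap hA g = spectralMap hA (fun x => f x - g x) := by
  rw [sub_eq_iff_eq_add, spectralMap_add]
  simp

theorem spectralMap_congr (hA : A.IsHermitian) {f g : ℝ → ℝ}
    (h : ∀ i, f (hA.eigenvalues i) = g (hA.eigenvalues i)) :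
    spectralMap hA f = spectralMap hA g := by
  simp only [spectralMap, h]

theorem spectralMap_posSemidef (hA : A.IsHermitian) {f : ℝ → ℝ}
    (hf : ∀ i, 0 ≤ f (hA.eigenvalues i)) : (spectralMap hA f).PosSemidef := by
  refine (PosSemidef.diagonal ?_).mul_mul_conjTranspose_same _
  intro i
  simpa using hf i

theorem trace_spectralMap (hA : A.IsHermitian) (f : ℝ → ℝ) :
    (spectralMap hA f).trace = ((∑ i, f (hA.eigenvalues i) : ℝ) : ℂ) := by
  have h : (hA.eigenvectorUnitary : Matrix n n ℂ)ᴴ * (hA.eigenvectorUnitary : Matrix n n ℂ) = 1 :=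
    Unitary.coe_star_mul_self _
  rw [spectralMap, trace_mul_cycle, h, Matrix.one_mul, trace_diagonal]
  simp

/-- Square root of a positive semidefinite matrix together with its pseudo-inverse. -/
theorem exists_sqrt_pinv (hA : A.PosSemidef) :
    ∃ S G : Matrix n n ℂ, S.PosSemidef ∧ G.PosSemidef ∧ S * S = A ∧ S * G = G * S ∧
      S * G * S = S ∧ G * S * G = G ∧ (1 - S * G).PosSemidef ∧
      S.trace = ((∑ i, √(hA.1.eigenvalues i) : ℝ) : ℂ) := by
  refine ⟨spectralMap hA.1 (fun x => √x), spectralMap hA.1 (fun x => (√x)⁻¹),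
    spectralMap_posSemidef _ fun i => Real.sqrt_nonneg _,
    spectralMap_posSemidef _ fun i => inv_nonneg.2 (Real.sqrt_nonneg _), ?_, ?_, ?_, ?_, ?_,
    trace_spectralMap _ _⟩
  · rw [spectralMap_mul]
    conv_rhs => rw [← spectralMap_id hA.1]
    exact spectralMap_congr _ fun i => Real.mul_self_sqrt (hA.eigenvalues_nonneg i)
  · rw [spectralMap_mul, spectralMap_mul]
    exact spectralMap_congr _ fun i => mul_comm _ _
  · rw [spectralMap_mul, spectralMap_mul]
    exact spectralMap_congr _ fun i => mul_inv_mul_cancel _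
  · rw [spectralMap_mul, spectralMap_mul]
    refine spectralMap_congr _ fun i => ?_
    simpa using mul_inv_mul_cancel (√(hA.1.eigenvalues i))⁻¹
  · rw [spectralMap_mul, ← spectralMap_one hA.1, spectralMap_sub]
    refine spectralMap_posSemidef _ fun i => ?_
    rw [sub_nonneg]
    exact mul_inv_le_one

end SpectralMap

/-! ### Hilbert–Schmidt norm and trace inequalities. -/

section HilbertSchmidt

variable {a b c : Type*} [Fintype a] [Fintype b] [Fintype c]

/-- Squared Hilbert–Schmidt norm. -/
noncomputable def hsSq (A : Matrix a b ℂ) : ℝ := ∑ i, ∑ j, ‖A i j‖ ^ 2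

theorem hsSq_nonneg (A : Matrix a b ℂ) : 0 ≤ hsSq A :=
  Finset.sum_nonneg fun _ _ => Finset.sum_nonneg fun _ _ => by positivity

theorem trace_mul_conjTranspose_self (A : Matrix a b ℂ) : (A * Aᴴ).trace = (hsSq A : ℂ) := by
  simp [hsSq, Matrix.trace, Matrix.mul_apply, Complex.mul_conj, Complex.normSq_eq_norm_sq]

theorem hsSq_eq_re_trace (A : Matrix a b ℂ) : hsSq A = (A * Aᴴ).trace.re := by
  rw [trace_mul_conjTranspose_self]; simp

theorem hsSq_conjTranspose (A : Matrix a b ℂ) : hsSq Aᴴ = hsSq A := by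
  unfold hsSq
  rw [Finset.sum_comm]
  simp

theorem hsSq_transpose (A : Matrix a b ℂ) : hsSq Aᵀ = hsSq A := by
  unfold hsSq
  rw [Finset.sum_comm]
  simp

theorem re_trace_mul_conjTranspose_le (A B : Matrix a b ℂ) :
    (A * Bᴴ).trace.re ≤ √(hsSq A) * √(hsSq B) := by
  have h : (A * Bᴴ).trace = ∑ p : a × b, A p.1 p.2 * star (B p.1 p.2) := by
    simp [Matrix.trace, Matrix.mul_apply, Fintype.sum_prod_type]
  calc (A * Bᴴ).trace.re ≤ ‖(A * Bᴴ).trace‖ := Complex.re_le_norm _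
    _ ≤ ∑ p : a × b, ‖A p.1 p.2‖ * ‖B p.1 p.2‖ := by
        rw [h]
        refine (norm_sum_le _ _).trans (le_of_eq ?_)
        simp
    _ ≤ √(∑ p : a × b, ‖A p.1 p.2‖ ^ 2) * √(∑ p : a × b, ‖B p.1 p.2‖ ^ 2) :=
        Real.sum_mul_le_sqrt_mul_sqrt _ _ _
    _ = _ := by simp [hsSq, Fintype.sum_prod_type]

theorem re_trace_conjTranspose (A : Matrix a a ℂ) : Aᴴ.trace.re = A.trace.re := by
  rw [trace_conjTranspose]; simp

theorem hsSq_sub (A B : Matrix a b ℂ) :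
    hsSq (A - B) = hsSq A + hsSq B - 2 * (A * Bᴴ).trace.re := by
  have h : (B * Aᴴ).trace.re = (A * Bᴴ).trace.re := by
    rw [← re_trace_conjTranspose]; simp
  simp only [hsSq_eq_re_trace, conjTranspose_sub, Matrix.sub_mul, Matrix.mul_sub, trace_sub,
    Complex.sub_re, h]
  ring

theorem re_trace_nonneg_of_posSemidef {A : Matrix a a ℂ} (hA : A.PosSemidef) : 0 ≤ A.trace.re := by
  have := hA.trace_nonneg
  exact (Complex.le_def.1 this).1

/-- The trace of a product of two positive semidefinite matrices is nonnegative. -/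
theorem re_trace_mul_nonneg [DecidableEq a] {A B : Matrix a a ℂ} (hA : A.PosSemidef)
    (hB : B.PosSemidef) : 0 ≤ (A * B).trace.re := by
  obtain ⟨S, -, hS, -, hSS, -⟩ := exists_sqrt_pinv hA
  rw [← hSS, Matrix.mul_assoc, trace_mul_comm]
  have := hB.mul_mul_conjTranspose_same S
  rw [hS.1.eq] at this
  exact re_trace_nonneg_of_posSemidef this

theorem hsSq_mul_add_of_le [DecidableEq b] (U : Matrix a b ℂ) (A : Matrix b c ℂ) :
    hsSq (U * A) + (Aᴴ * (1 - Uᴴ * U) * A).trace.re = hsSq A := by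
  rw [← hsSq_conjTranspose, ← hsSq_conjTranspose A, hsSq_eq_re_trace, hsSq_eq_re_trace,
    ← Complex.add_re, ← trace_add]
  congr 2
  simp only [conjTranspose_mul, conjTranspose_conjTranspose, Matrix.mul_sub, Matrix.sub_mul,
    Matrix.mul_one, Matrix.mul_assoc]
  abel

theorem hsSq_mul_le [DecidableEq b] {U : Matrix a b ℂ} (hU : (1 - Uᴴ * U).PosSemidef)
    (A : Matrix b c ℂ) : hsSq (U * A) ≤ hsSq A := by
  have h := hsSq_mul_add_of_le U A
  have := re_trace_nonneg_of_posSemidef (hU.conjTranspose_mul_mul_same A)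
  linarith

end HilbertSchmidt

/-! ### Powers–Størmer and weighted Cauchy–Schwarz. -/

section Inequalities

variable {n : Type*} [Fintype n] [DecidableEq n]

/-- A form of the Powers–Størmer inequality. -/
theorem exists_sign_hsSq_sub_le {A B : Matrix n n ℂ} (hA : A.PosSemidef) (hB : B.PosSemidef) :
    ∃ S : Matrix n n ℂ, S.IsHermitian ∧ S * S = 1 ∧
      hsSq (A - B) ≤ (S * (A * A - B * B)).trace.re := by
  have hD : (A - B).IsHermitian := hA.1.sub hB.1
  -- The sign at 0 is taken to be 1, so that S² = 1 even when A - B is singular.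
  set sg : ℝ → ℝ := fun x => if 0 ≤ x then 1 else -1 with hsg
  have habs : ∀ x : ℝ, sg x * x = |x| := by
    intro x
    simp only [hsg]
    split_ifs with h
    · rw [abs_of_nonneg h, one_mul]
    · rw [abs_of_neg (not_le.1 h)]; ring
  set S := spectralMap hD sg with hS
  set N := spectralMap hD (fun x => |x|) with hN
  have hSD : S * (A - B) = N := by
    conv_lhs => rw [← spectralMap_id hD, hS, spectralMap_mul]
    exact spectralMap_congr _ fun i => habs _
  have hDS : (A - B) * S = N := by
    conv_lhs => rw [← spectralMap_id hD, hS, spectralMap_mul]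
    exact spectralMap_congr _ fun i => by rw [mul_comm]; exact habs _
  have hm : (N - (A - B)).PosSemidef := by
    have : N - (A - B) = spectralMap hD (fun x => |x| - x) := by
      rw [← spectralMap_sub, spectralMap_id]
    rw [this]
    exact spectralMap_posSemidef _ fun i => sub_nonneg.2 (le_abs_self _)
  have hp : (N + (A - B)).PosSemidef := by
    have : N + (A - B) = spectralMap hD (fun x => |x| + x) := by
      rw [← spectralMap_add, spectralMap_id]
    rw [this]
    exact spectralMap_posSemidef _ fun i => by linarith [neg_abs_le (hD.eigenvalues i)]
  refine ⟨S, spectralMap_isHermitian _ _, ?_, ?_⟩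
  · rw [hS, spectralMap_mul, ← spectralMap_one hD]
    refine spectralMap_congr _ fun i => ?_
    simp only [hsg]; split_ifs <;> norm_num
  have key : (S * (A * A - B * B)).trace = (N * (A + B)).trace := by
    -- Symmetrizing puts a factor A - B at the left or right end of each term, where S turns it into
    -- |A - B|.
    have e : (2 : ℂ) • (A * A - B * B) = (A - B) * (A + B) + (A + B) * (A - B) := by
      rw [two_smul]; noncomm_ring
    have : (2 : ℂ) • (S * (A * A - B * B)).trace = (2 : ℂ) • (N * (A + B)).trace := by
      rw [← trace_smul, ← Matrix.mul_smul, e, Matrix.mul_add, trace_add, ← Matrix.mul_assoc,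
        hSD, ← Matrix.mul_assoc, trace_mul_comm (S * (A + B)), ← Matrix.mul_assoc, hDS, two_smul]
    simpa using this
  -- With D = A - B, the deficit is Tr (|D| - D)A + Tr (|D| + D)B, and both traces are nonnegative.
  have e2 : (S * (A * A - B * B)).trace.re - hsSq (A - B) =
      ((N - (A - B)) * A).trace.re + ((N + (A - B)) * B).trace.re := by
    rw [key, hsSq_eq_re_trace, hD.eq, ← Complex.sub_re, ← Complex.add_re, ← trace_sub,
      ← trace_add]
    congr 2
    noncomm_ring
  have h1 := re_trace_mul_nonneg hm hA
  have h2 := re_trace_mul_nonneg hp hB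
  linarith

/-- Cauchy–Schwarz inequality with the weight `s ^ 4`. -/
theorem re_trace_mul_sandwich_le {S s : Matrix n n ℂ} (hS : S.IsHermitian) (hSS : S * S = 1)
    (hs : s.IsHermitian) (Y : Matrix n n ℂ) :
    (S * (s * Y * s)).trace.re ≤ √((s * s * (s * s)).trace.re) * √(hsSq Y) := by
  have hE : (S * (s * Y * s)).trace = ((s * S * s) * (Yᴴ)ᴴ).trace := by
    rw [conjTranspose_conjTranspose, ← Matrix.mul_assoc, trace_mul_comm]
    simp only [Matrix.mul_assoc]
  rw [hE]
  refine (re_trace_mul_conjTranspose_le _ _).trans ?_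
  rw [hsSq_conjTranspose]
  refine mul_le_mul_of_nonneg_right (Real.sqrt_le_sqrt ?_) (Real.sqrt_nonneg _)
  -- By cyclicity ‖sSs‖² = Tr Z², so a second Cauchy–Schwarz bounds it by ‖Z‖² = Tr s⁴, where S² = 1
  -- removes S.
  set Z := s * s * S with hZ
  have h1 : hsSq (s * S * s) = (Z * (Zᴴ)ᴴ).trace.re := by
    rw [hsSq_eq_re_trace, conjTranspose_conjTranspose]
    simp only [conjTranspose_mul, hs.eq, hS.eq, hZ]
    congr 1
    have := trace_mul_comm s (s * (S * (s * (s * S))))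
    simp only [Matrix.mul_assoc] at this ⊢
    exact this.symm
  have h2 : hsSq Z = (s * s * (s * s)).trace.re := by
    rw [hsSq_eq_re_trace, hZ]
    simp only [conjTranspose_mul, hs.eq, hS.eq, Matrix.mul_assoc]
    rw [← Matrix.mul_assoc S S, hSS, Matrix.one_mul]
  rw [h1, ← h2]
  refine (re_trace_mul_conjTranspose_le _ _).trans (le_of_eq ?_)
  rw [hsSq_conjTranspose, Real.mul_self_sqrt (hsSq_nonneg _)]

end Inequalities

/-! ### Polar decomposition and Uhlmann's theorem. -/

section Polar

variable {a b c : Type*} [Fintype a] [DecidableEq a] [Fintype b] [DecidableEq b]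
  [Fintype c]

/-- Left polar decomposition. -/
theorem exists_polar (M : Matrix a b ℂ) :
    ∃ (A : Matrix a a ℂ) (W : Matrix a b ℂ), A.PosSemidef ∧ A * A = M * Mᴴ ∧ M = A * W ∧
      M * Wᴴ = A ∧ (W * Wᴴ) * A = A ∧ (1 - W * Wᴴ).PosSemidef ∧ (1 - Wᴴ * W).PosSemidef ∧
      A.trace = ((∑ i, √((posSemidef_self_mul_conjTranspose M).1.eigenvalues i) : ℝ) : ℂ) := by
  obtain ⟨A, G, hA, hG, hAA, hAG, hAGA, hGAG, hle, htr⟩ :=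
    exists_sqrt_pinv (posSemidef_self_mul_conjTranspose M)
  have hMW : M * (G * M)ᴴ = A := by
    rw [conjTranspose_mul, hG.1.eq, ← Matrix.mul_assoc, ← hAA, Matrix.mul_assoc, hAG,
      ← Matrix.mul_assoc, hAGA]
  have hWW : (G * M) * (G * M)ᴴ = A * G := by rw [Matrix.mul_assoc, hMW, hAG]
  have hM : M = A * (G * M) := by
    -- The pseudo-inverse need not be an inverse, so equality is obtained by showing that the
    -- difference D satisfies D Dᴴ = 0.
    have : (M - A * (G * M)) * (M - A * (G * M))ᴴ = 0 := by
      have e : (A * (G * M))ᴴ = Mᴴ * (A * G) := by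
        rw [conjTranspose_mul, conjTranspose_mul, hA.1.eq, hG.1.eq, Matrix.mul_assoc, hAG]
      rw [conjTranspose_sub, e, Matrix.sub_mul, Matrix.mul_sub, Matrix.mul_sub,
        ← Matrix.mul_assoc M, ← hAA]
      have e1 : A * A * (A * G) = A * A := by
        rw [Matrix.mul_assoc, hAG, ← Matrix.mul_assoc A G, hAGA]
      have e2 : A * (G * M) * Mᴴ = A * A := by
        rw [Matrix.mul_assoc, Matrix.mul_assoc, ← hAA, ← Matrix.mul_assoc G, ← hAG, hAGA]
      rw [e1, ← Matrix.mul_assoc _ Mᴴ, e2, e1]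
      simp
    exact sub_eq_zero.1 (self_mul_conjTranspose_eq_zero.1 this)
  refine ⟨A, G * M, hA, hAA, hM, hMW, by rw [hWW, hAGA], by rw [hWW]; exact hle, ?_, htr⟩
  -- WᴴW is a projection, so 1 - WᴴW equals its own square and is positive.
  have hP : ((G * M)ᴴ * (G * M)) * ((G * M)ᴴ * (G * M)) = (G * M)ᴴ * (G * M) := by
    rw [Matrix.mul_assoc, ← Matrix.mul_assoc (G * M) (G * M)ᴴ, hWW, ← Matrix.mul_assoc (A * G),
      hAG, hGAG]
  have hh : ((G * M)ᴴ * (G * M))ᴴ = (G * M)ᴴ * (G * M) := by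
    rw [conjTranspose_mul, conjTranspose_conjTranspose]
  have := posSemidef_conjTranspose_mul_self (1 - (G * M)ᴴ * (G * M))
  rw [conjTranspose_sub, conjTranspose_one, hh, Matrix.sub_mul, Matrix.mul_sub,
    Matrix.mul_sub, hP] at this
  simpa using this

/-- Uses 1 - VWWᴴVᴴ = (1 - VVᴴ) + V(1 - WWᴴ)Vᴴ. -/
theorem posSemidef_one_sub_mul_conjTranspose {V : Matrix a b ℂ} {W : Matrix b c ℂ}
    (hV : (1 - V * Vᴴ).PosSemidef) (hW : (1 - W * Wᴴ).PosSemidef) :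
    (1 - (V * W) * (V * W)ᴴ).PosSemidef := by
  have := hV.add (hW.mul_mul_conjTranspose_same V)
  convert this using 1
  rw [conjTranspose_mul, Matrix.mul_sub, Matrix.sub_mul, Matrix.mul_one]
  simp only [Matrix.mul_assoc]
  abel

/-- Approximate form of Uhlmann's theorem: if the reduced states `M Mᴴ` and `N Nᴴ` of two pure
states are close, then a contraction on the purifying system maps one close to the other. -/
theorem exists_contraction_overlap [DecidableEq c] (M : Matrix a b ℂ) (N : Matrix a c ℂ) :
    ∃ (V : Matrix c b ℂ) (S : Matrix a a ℂ), (1 - Vᴴ * V).PosSemidef ∧ S.IsHermitian ∧ S * S = 1 ∧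
      hsSq M + hsSq N - 2 * ((M * Vᵀ) * Nᴴ).trace.re ≤ (S * (M * Mᴴ - N * Nᴴ)).trace.re := by
  obtain ⟨A, W, hA, hAA, hM, hMW, -, -, hW, -⟩ := exists_polar M
  obtain ⟨B, X, hB, hBB, hN, hNX, hXB, hX, -, -⟩ := exists_polar N
  obtain ⟨S, hS, hSS, hle⟩ := exists_sign_hsSq_sub_le hA hB
  -- Chosen so that the overlap becomes Tr AB, with A, B the positive polar parts. The transpose
  -- appears because an operator V on the purifying system sends M to MVᵀ.
  refine ⟨(Wᴴ * X)ᵀ, S, ?_, hS, hSS, ?_⟩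
  · have h := posSemidef_one_sub_mul_conjTranspose (V := Wᴴ) (W := X) (by simpa using hW) hX
    have e : 1 - ((Wᴴ * X)ᵀ)ᴴ * (Wᴴ * X)ᵀ = (1 - (Wᴴ * X) * (Wᴴ * X)ᴴ)ᵀ := by
      rw [transpose_sub, transpose_one, transpose_mul (Wᴴ * X) (Wᴴ * X)ᴴ]
      rfl
    rw [e]
    exact h.transpose
  · rw [transpose_transpose, ← hAA, ← hBB]
    have e : (M * (Wᴴ * X) * Nᴴ).trace = (A * Bᴴ).trace := by
      have hN' : Nᴴ = Xᴴ * B := by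
        conv_lhs => rw [hN, conjTranspose_mul, hB.1.eq]
      rw [← Matrix.mul_assoc, hMW, hN', ← Matrix.mul_assoc, Matrix.mul_assoc A,
        Matrix.mul_assoc A, hXB, hB.1.eq]
    have hMA : hsSq M = hsSq A := by
      rw [hsSq_eq_re_trace, hsSq_eq_re_trace, hA.1.eq, hAA]
    have hNB : hsSq N = hsSq B := by
      rw [hsSq_eq_re_trace, hsSq_eq_re_trace, hB.1.eq, hBB]
    rw [e, hMA, hNB, ← hsSq_sub]
    exact hle

/-- The trace norm is attained by a contraction. -/
theorem exists_contraction_traceNorm (X : Matrix a a ℂ) :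
    ∃ U : Matrix a a ℂ, (1 - Uᴴ * U).PosSemidef ∧ traceNorm X = (U * X).trace.re := by
  obtain ⟨A, W, -, -, -, hA, -, -, hW, htr⟩ := exists_polar Xᴴ
  refine ⟨W, hW, ?_⟩
  have e : (W * X).trace.re = A.trace.re := by
    rw [← hA, ← re_trace_conjTranspose, conjTranspose_mul]
  -- `traceNorm` diagonalizes with a classical `DecidableEq` instance and XᴴX, the polar lemma with
  -- the ambient instance and Xᴴ(Xᴴ)ᴴ; this identifies the two.
  have key : ∀ (Y : Matrix a a ℂ) (h : Y.IsHermitian) (hY : Y = Xᴴ * X) (i : DecidableEq a),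
      ∑ j, √((@Matrix.IsHermitian.eigenvalues ℂ _ a _ Y i h) j) = traceNorm X := by
    intro Y h hY i
    subst hY
    unfold traceNorm
    congr!
  rw [e, htr, Complex.ofReal_re]
  exact (key _ _ (by rw [conjTranspose_conjTranspose]) _).symm

end Polar

/-! ### Extending a contraction to a channel. -/

section Completion

variable {y z : Type*} [Fintype y] [DecidableEq y] [Fintype z] [DecidableEq z]

/-- A contraction is the first Kraus operator of some channel. -/
theorem exists_kraus_completion [Nonempty z] (V : Matrix z y ℂ) (hV : (1 - Vᴴ * V).PosSemidef) :
    ∃ u : Fin (Fintype.card y) → Matrix z y ℂ, Vᴴ * V + ∑ k, (u k)ᴴ * u k = 1 := by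
  obtain ⟨G, -, hG, -, hGG, -⟩ := exists_sqrt_pinv hV
  obtain ⟨z₀⟩ := ‹Nonempty z›
  -- The operators |z₀⟩⟨k|G, with G² = 1 - VᴴV: everything V loses is sent to one fixed state z₀.
  refine ⟨fun k => (Matrix.single z₀ ((Fintype.equivFin y).symm k) 1 : Matrix z y ℂ) * G, ?_⟩
  have h1 : ∀ j : y, ((Matrix.single z₀ j 1 : Matrix z y ℂ) * G)ᴴ *
      ((Matrix.single z₀ j 1 : Matrix z y ℂ) * G) =
      G * (Matrix.single j j 1 : Matrix y y ℂ) * G := by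
    intro j
    rw [conjTranspose_mul, hG.1.eq, conjTranspose_single, Matrix.mul_assoc,
      ← Matrix.mul_assoc (Matrix.single j z₀ _), Matrix.single_mul_single_same, Matrix.mul_assoc,
      star_one, mul_one]
  have h2 : ∑ j : y, Matrix.single j j (1 : ℂ) = 1 := by
    ext i k
    simp [Matrix.sum_apply, Matrix.single_apply, Matrix.one_apply, ite_and]
  rw [Equiv.sum_comp (Fintype.equivFin y).symm
    (fun j => ((Matrix.single z₀ j 1 : Matrix z y ℂ) * G)ᴴ *
      ((Matrix.single z₀ j 1 : Matrix z y ℂ) * G))]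
  simp only [h1]
  rw [← Finset.sum_mul, ← Finset.mul_sum, h2, Matrix.mul_one, hGG]
  abel

end Completion

/-! ### Trace distance between ensembles of pure states. -/

section TraceNorm

variable {a : Type*} [Fintype a]

/-- Squared Euclidean norm of a vector. -/
noncomputable def vecSq (v : a → ℂ) : ℝ := ∑ i, ‖v i‖ ^ 2

theorem vecSq_nonneg (v : a → ℂ) : 0 ≤ vecSq v := Finset.sum_nonneg fun _ _ => by positivity

theorem vecSq_eq_hsSq (v : a → ℂ) : vecSq v = hsSq (replicateCol Unit v) := by
  simp [vecSq, hsSq]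

theorem pureState_eq {a : Type*} (v : a → ℂ) :
    pureState v = replicateCol Unit v * (replicateCol Unit v)ᴴ := by
  rw [pureState, vecMulVec_eq Unit, conjTranspose_replicateCol]

variable [DecidableEq a]

theorem re_trace_mul_pureState_le {U : Matrix a a ℂ} (hU : (1 - Uᴴ * U).PosSemidef)
    (v : a → ℂ) : (U * pureState v).trace.re ≤ vecSq v := by
  rw [pureState_eq, vecSq_eq_hsSq, ← Matrix.mul_assoc]
  refine (re_trace_mul_conjTranspose_le _ _).trans ?_
  refine (mul_le_mul_of_nonneg_right (Real.sqrt_le_sqrt (hsSq_mul_le hU _))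
    (Real.sqrt_nonneg _)).trans_eq ?_
  rw [Real.mul_self_sqrt (hsSq_nonneg _)]

/-- Telescopes vvᴴ - wwᴴ = v(v - w)ᴴ + (v - w)wᴴ and applies Cauchy–Schwarz to each piece. -/
theorem re_trace_mul_pureState_sub_le {U : Matrix a a ℂ} (hU : (1 - Uᴴ * U).PosSemidef)
    (v w : a → ℂ) : (U * (pureState v - pureState w)).trace.re ≤
      √(vecSq (v - w)) * (√(vecSq v) + √(vecSq w)) := by
  have e : replicateCol Unit v - replicateCol Unit w = replicateCol Unit (v - w) := by
    ext; simp
  have h : U * (pureState v - pureState w) =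
      (U * replicateCol Unit v) * (replicateCol Unit (v - w))ᴴ +
      (U * replicateCol Unit (v - w)) * (replicateCol Unit w)ᴴ := by
    rw [pureState_eq, pureState_eq, ← e, conjTranspose_sub]
    simp only [Matrix.mul_sub, Matrix.sub_mul, Matrix.mul_assoc]
    abel
  rw [h, trace_add, Complex.add_re]
  have h1 := re_trace_mul_conjTranspose_le (U * replicateCol Unit v) (replicateCol Unit (v - w))
  have h2 := re_trace_mul_conjTranspose_le (U * replicateCol Unit (v - w)) (replicateCol Unit w)
  have h3 := mul_le_mul_of_nonneg_right (Real.sqrt_le_sqrt (hsSq_mul_le hU (replicateCol Unit v)))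
    (Real.sqrt_nonneg (hsSq (replicateCol Unit (v - w))))
  have h4 := mul_le_mul_of_nonneg_right
    (Real.sqrt_le_sqrt (hsSq_mul_le hU (replicateCol Unit (v - w))))
    (Real.sqrt_nonneg (hsSq (replicateCol Unit w)))
  simp only [vecSq_eq_hsSq]
  linarith

/-- Trace norm bound for an ensemble of pure states that approximates another one. -/
theorem traceNorm_sum_le {ι κ : Type*} [Fintype ι] [Fintype κ] (v w : ι → a → ℂ)
    (u : ι → κ → a → ℂ) (d p : ι → ℝ)
    (hd : ∀ j, vecSq (v j - w j) + ∑ k, vecSq (u j k) ≤ d j)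
    (hp : ∀ j, vecSq (v j) + ∑ k, vecSq (u j k) ≤ p j)
    (hp1 : ∑ j, p j ≤ 1) (hw : ∑ j, vecSq (w j) ≤ 1) :
    traceNorm (∑ j, (pureState (v j) + ∑ k, pureState (u j k) - pureState (w j))) ≤
      3 * √(∑ j, d j) := by
  obtain ⟨U, hU, hUX⟩ := exists_contraction_traceNorm
    (∑ j, (pureState (v j) + ∑ k, pureState (u j k) - pureState (w j)))
  have hr : ∀ j, 0 ≤ ∑ k, vecSq (u j k) := fun j => Finset.sum_nonneg fun k _ => vecSq_nonneg _
  have hd0 : ∀ j, 0 ≤ d j := fun j => by linarith [hd j, hr j, vecSq_nonneg (v j - w j)]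
  have hp0 : ∀ j, 0 ≤ p j := fun j => by linarith [hp j, hr j, vecSq_nonneg (v j)]
  have hj : ∀ j, (U * (pureState (v j) + ∑ k, pureState (u j k) - pureState (w j))).trace.re ≤
      2 * (√(d j) * √(p j)) + √(d j) * √(vecSq (w j)) := by
    intro j
    have h1 := re_trace_mul_pureState_sub_le hU (v j) (w j)
    have h2 : (U * ∑ k, pureState (u j k)).trace.re ≤ ∑ k, vecSq (u j k) := by
      rw [Matrix.mul_sum, trace_sum, Complex.re_sum]
      exact Finset.sum_le_sum fun k _ => re_trace_mul_pureState_le hU _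
    have h3 : (U * (pureState (v j) + ∑ k, pureState (u j k) - pureState (w j))).trace.re =
        (U * (pureState (v j) - pureState (w j))).trace.re +
          (U * ∑ k, pureState (u j k)).trace.re := by
      rw [← Complex.add_re, ← trace_add, ← Matrix.mul_add]
      congr 3
      abel
    -- The waste is at most `d j` and at most `p j`, hence at most their geometric mean; in this
    -- form it sums by Cauchy–Schwarz like the other two terms, which gives the constant 3.
    have h4 : ∑ k, vecSq (u j k) ≤ √(d j) * √(p j) := by
      rw [← Real.mul_self_sqrt (hr j)]
      exact mul_le_mul (Real.sqrt_le_sqrt (by linarith [hd j, vecSq_nonneg (v j - w j)]))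
        (Real.sqrt_le_sqrt (by linarith [hp j, vecSq_nonneg (v j)])) (Real.sqrt_nonneg _)
        (Real.sqrt_nonneg _)
    have h5 : √(vecSq (v j - w j)) ≤ √(d j) := Real.sqrt_le_sqrt (by linarith [hd j, hr j])
    have h6 : √(vecSq (v j)) ≤ √(p j) := Real.sqrt_le_sqrt (by linarith [hp j, hr j])
    have h7 : √(vecSq (v j - w j)) * (√(vecSq (v j)) + √(vecSq (w j))) ≤
        √(d j) * (√(p j) + √(vecSq (w j))) :=
      mul_le_mul h5 (by linarith) (by positivity) (Real.sqrt_nonneg _)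
    linarith
  rw [hUX, Matrix.mul_sum, trace_sum, Complex.re_sum]
  refine (Finset.sum_le_sum fun j _ => hj j).trans ?_
  rw [Finset.sum_add_distrib, ← Finset.mul_sum]
  have cs : ∀ f : ι → ℝ, (∀ j, 0 ≤ f j) → ∑ j, f j ≤ 1 →
      ∑ j, √(d j) * √(f j) ≤ √(∑ j, d j) := by
    intro f hf hf1
    refine (Real.sum_mul_le_sqrt_mul_sqrt _ _ _).trans ?_
    simp only [Real.sq_sqrt (hd0 _), Real.sq_sqrt (hf _)]
    exact mul_le_of_le_one_right (Real.sqrt_nonneg _) (Real.sqrt_le_one.2 hf1)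
  have h1 := cs p hp0 hp1
  have h2 := cs (fun j => vecSq (w j)) (fun j => vecSq_nonneg _) hw
  linarith

end TraceNorm

/-! ### Moments of the eight-point distribution. -/

section Moments

/-- Eight equally likely values of a complex variable whose moments of order at most four agree
with those of a standard complex Gaussian variable. -/
noncomputable def sample : Fin 8 → ℂ :=
  ![0, 0, 0, 0, (√2 : ℝ), (√2 : ℝ) * Complex.I, -(√2 : ℝ), -((√2 : ℝ) * Complex.I)]

theorem sqrt_two_sq : ((√2 : ℝ) : ℂ) ^ 2 = 2 := by
  rw [← Complex.ofReal_pow, Real.sq_sqrt (by norm_num)]; simp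

/-- The restriction to exponents at most 2 matters: the plain fourth moment is 2, not the Gaussian
0. Only these mixed moments are needed below. -/
theorem sum_sample_moment (s t : ℕ) (hs : s ≤ 2) (ht : t ≤ 2) :
    ∑ x, sample x ^ s * star (sample x) ^ t = 8 * if s = t then (s.factorial : ℂ) else 0 := by
  have h2 := sqrt_two_sq
  have h4 : ((√2 : ℝ) : ℂ) ^ 4 = 4 := by
    calc ((√2 : ℝ) : ℂ) ^ 4 = (((√2 : ℝ) : ℂ) ^ 2) ^ 2 := by ring
      _ = 4 := by rw [h2]; norm_num
  interval_cases s <;> interval_cases t <;>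
    simp [Fin.sum_univ_eight, sample, Nat.factorial, mul_pow] <;> ring_nf <;>
    simp [h2, h4] <;> norm_num

variable {ι : Type*} [Fintype ι] [DecidableEq ι]

theorem prod_pow_indicator (F : ι → ℂ) (p : ι) :
    ∏ x, F x ^ (if x = p then 1 else 0) = F p := by
  rw [Finset.prod_eq_single p] <;> simp +contextual

/-- Entries at different positions are independent, so the sum factors over positions, and an
unpaired entry has mean zero. -/
theorem sum_sample_two (p q : ι) :
    ∑ f : ι → Fin 8, sample (f p) * star (sample (f q)) =
      (8 : ℂ) ^ Fintype.card ι * if p = q then 1 else 0 := by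
  have h : ∀ f : ι → Fin 8, sample (f p) * star (sample (f q)) =
      ∏ x, (sample (f x) ^ (if x = p then 1 else 0) *
        star (sample (f x)) ^ (if x = q then 1 else 0)) := by
    intro f
    rw [Finset.prod_mul_distrib, prod_pow_indicator (fun x => sample (f x)),
      prod_pow_indicator (fun x => star (sample (f x)))]
  simp only [h]
  rw [← Fintype.prod_sum (fun x j => (sample j ^ (if x = p then 1 else 0) *
        star (sample j) ^ (if x = q then 1 else 0)))]
  rw [Finset.prod_congr rfl fun x _ => sum_sample_moment _ _ (by split_ifs <;> norm_num)
    (by split_ifs <;> norm_num), Finset.prod_mul_distrib, Finset.prod_const, Finset.card_univ]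
  congr 1
  split_ifs with hpq
  · subst hpq
    refine Finset.prod_eq_one fun x _ => ?_
    rw [if_pos rfl]
    split_ifs <;> simp
  · exact Finset.prod_eq_zero (Finset.mem_univ p) (by simp [hpq])

/-- Wick's rule. When all four positions coincide both pairings count, in agreement with the moment
E|x|⁴ = 2. -/
theorem sum_sample_four (p q r s : ι) :
    ∑ f : ι → Fin 8, sample (f p) * sample (f q) * star (sample (f r)) * star (sample (f s)) =
      (8 : ℂ) ^ Fintype.card ι *
        ((if p = r then 1 else 0) * (if q = s then 1 else 0) +
          (if p = s then 1 else 0) * (if q = r then 1 else 0)) := by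
  have h : ∀ f : ι → Fin 8,
      sample (f p) * sample (f q) * star (sample (f r)) * star (sample (f s)) =
      ∏ x, (sample (f x) ^ ((if x = p then 1 else 0) + (if x = q then 1 else 0)) *
        star (sample (f x)) ^ ((if x = r then 1 else 0) + (if x = s then 1 else 0))) := by
    intro f
    simp only [pow_add, Finset.prod_mul_distrib]
    rw [prod_pow_indicator (fun x => sample (f x)), prod_pow_indicator (fun x => sample (f x)),
      prod_pow_indicator (fun x => star (sample (f x))),
      prod_pow_indicator (fun x => star (sample (f x))), mul_assoc _ (star _)]
  simp only [h]
  rw [← Fintype.prod_sum (fun x j => (sample j ^ ((if x = p then 1 else 0) +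
    (if x = q then 1 else 0)) *
        star (sample j) ^ ((if x = r then 1 else 0) + (if x = s then 1 else 0))))]
  rw [Finset.prod_congr rfl fun x _ => sum_sample_moment _ _ (by split_ifs <;> norm_num)
    (by split_ifs <;> norm_num), Finset.prod_mul_distrib, Finset.prod_const, Finset.card_univ]
  congr 1
  by_cases hpq : p = q
  · subst hpq
    by_cases hr : p = r
    · subst hr
      by_cases hs : p = s
      · subst hs
        rw [Finset.prod_eq_single p]
        · simp; norm_num
        · intro x _ hx; simp [hx]
        · simp
      · rw [Finset.prod_eq_zero (Finset.mem_univ p) (by simp [hs])]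
        simp [hs]
    · rw [Finset.prod_eq_zero (Finset.mem_univ p) (by grind)]
      simp [hr]
  · by_cases h1 : p = r ∧ q = s
    · obtain ⟨rfl, rfl⟩ := h1
      rw [Finset.prod_eq_one]
      · simp [hpq]
      · intro x _
        by_cases h3 : x = p
        · subst h3; simp [hpq]
        · by_cases h4 : x = q
          · subst h4; simp [h3]
          · simp [h3, h4]
    · by_cases h2 : p = s ∧ q = r
      · obtain ⟨rfl, rfl⟩ := h2
        rw [Finset.prod_eq_one]
        · simp [hpq]
        · intro x _
          by_cases h3 : x = p
          · subst h3; simp [hpq]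
          · by_cases h4 : x = q
            · subst h4; simp [h3]
            · simp [h3, h4]
      · have hR : ((if p = r then 1 else 0) * (if q = s then 1 else 0) +
          (if p = s then 1 else 0) * (if q = r then 1 else 0) : ℂ) = 0 := by
          rw [ite_zero_mul_ite_zero, ite_zero_mul_ite_zero, if_neg h1, if_neg h2, add_zero]
        rw [hR]
        have hqp : q ≠ p := Ne.symm hpq
        -- As neither pairing holds, at least one of p and q has no conjugated partner, and its
        -- position contributes zero.
        by_cases hp : p ≠ r ∧ p ≠ s
        · exact Finset.prod_eq_zero (Finset.mem_univ p) (by simp [hp.1, hp.2, hpq])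
        · refine Finset.prod_eq_zero (Finset.mem_univ q) ?_
          have h3 : q ≠ r ∧ q ≠ s := by
            constructor
            · rintro rfl
              exact hp ⟨hpq, fun e => h2 ⟨e, rfl⟩⟩
            · rintro rfl
              exact hp ⟨fun e => h1 ⟨e, rfl⟩, hpq⟩
          simp [h3.1, h3.2, hqp]

end Moments

/-! ### Second moments for one sender. -/

section SingleSender

variable {l c k : Type*} [Fintype l] [DecidableEq l] [Fintype c] [DecidableEq c] [Fintype k]
  [DecidableEq k]

/-- Coefficients of the map `ρ ↦ Tr_k (A ρ Aᴴ)` for the random matrix `A` given by `f`, with the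
ancilla `k` in the (unnormalized) completely mixed state. -/
noncomputable def transferCoeff (f : l × (c × k) → Fin 8) (x x' : l) (y y' : c) : ℂ :=
  ∑ j, sample (f (x, y, j)) * star (sample (f (x', y', j)))

theorem sum_transferCoeff (x x' : l) (y y' : c) :
    ∑ f : l × (c × k) → Fin 8, transferCoeff f x x' y y' =
      (8 : ℂ) ^ Fintype.card (l × (c × k)) * Fintype.card k *
        ((if x = x' then 1 else 0) * (if y = y' then 1 else 0)) := by
  unfold transferCoeff
  rw [Finset.sum_comm]
  simp only [sum_sample_two, Prod.mk.injEq, and_true]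
  rw [Finset.sum_const, Finset.card_univ, nsmul_eq_mul, ite_zero_mul_ite_zero, mul_one]
  ring

/-- One Wick pairing identifies the ancilla indices and leaves both outputs free, giving L²K and
keeping the sender's system; the other forces x = x' with both ancillas free, giving LK² and tracing
that system out. -/
theorem sum_transferCoeff_mul_star (y y' w w' : c) :
    ∑ f : l × (c × k) → Fin 8, ∑ x, ∑ x', transferCoeff f x x' y y' *
        star (transferCoeff f x x' w w') =
      (8 : ℂ) ^ Fintype.card (l × (c × k)) *
        ((Fintype.card l ^ 2 * Fintype.card k) * ((if y = w then 1 else 0) *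
            (if y' = w' then 1 else 0)) +
          (Fintype.card l * Fintype.card k ^ 2) * ((if y = y' then 1 else 0) *
            (if w = w' then 1 else 0))) := by
  have h : ∀ x x', ∑ f : l × (c × k) → Fin 8, transferCoeff f x x' y y' *
        star (transferCoeff f x x' w w') = (8 : ℂ) ^ Fintype.card (l × (c × k)) *
        (Fintype.card k * ((if y = w then 1 else 0) * (if y' = w' then 1 else 0)) +
          (if x = x' then 1 else 0) * (Fintype.card k ^ 2 * ((if y = y' then 1 else 0) *
            (if w = w' then 1 else 0)))) := by
    intro x x'
    have e : ∀ f : l × (c × k) → Fin 8, transferCoeff f x x' y y' *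
        star (transferCoeff f x x' w w') = ∑ j, ∑ j',
          sample (f (x, y, j)) * sample (f (x', w', j')) * star (sample (f (x', y', j))) *
            star (sample (f (x, w, j'))) := by
      intro f
      unfold transferCoeff
      rw [star_sum, Finset.sum_mul_sum]
      refine Finset.sum_congr rfl fun j _ => Finset.sum_congr rfl fun j' _ => ?_
      rw [star_mul', star_star]
      ring
    simp only [e]
    rw [Finset.sum_comm]
    simp only [Finset.sum_comm (s := (Finset.univ : Finset (l × (c × k) → Fin 8))),
      sum_sample_four]
    simp only [← Finset.mul_sum]
    congr 1
    have e2 : ∀ j j' : k, ((if (x, y, j) = (x', y', j) then 1 else 0) *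
        (if (x', w', j') = (x, w, j') then 1 else 0) +
        (if (x, y, j) = (x, w, j') then 1 else 0) *
          (if (x', w', j') = (x', y', j) then 1 else 0) : ℂ)
        = (if x = x' then 1 else 0) * ((if y = y' then 1 else 0) * (if w = w' then 1 else 0)) +
          (if j = j' then 1 else 0) * ((if y = w then 1 else 0) * (if y' = w' then 1 else 0)) := by
      intro j j'
      simp only [ite_zero_mul_ite_zero]
      congr 1
      · exact if_congr (by simp only [Prod.mk.injEq]; grind) (by simp) rfl
      · exact if_congr (by simp only [Prod.mk.injEq]; grind) (by simp) rfl
    simp only [e2, Finset.sum_add_distrib, ← Finset.sum_mul, Finset.sum_const, Finset.card_univ,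
      nsmul_eq_mul, Finset.sum_ite_eq, Finset.mem_univ, if_true]
    ring
  rw [Finset.sum_comm]
  simp only [Finset.sum_comm (s := (Finset.univ : Finset (l × (c × k) → Fin 8))), h]
  simp only [← Finset.mul_sum, Finset.sum_add_distrib, ← Finset.sum_mul, Finset.sum_const,
    Finset.card_univ, nsmul_eq_mul, Finset.sum_ite_eq, Finset.mem_univ, if_true]
  ring

end SingleSender

/-! ### Expansion over subsets of senders. -/

section ManySenders

variable {m : ℕ} {C : Fin m → Type*} {K L : Fin m → ℕ}

/-- Measurement outcomes of one sender. -/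
abbrev Outcome (C : Fin m → Type*) (K L : Fin m → ℕ) (i : Fin m) : Type _ :=
  Fin (L i) × (C i × Fin (K i)) → Fin 8

theorem glue_eq_on {T : Finset (Fin m)} (t t' : ∀ i : {i // i ∈ T}, C i)
    (s s' : ∀ i : {i // i ∉ T}, C i) :
    (∀ i ∈ T, (Equiv.piEquivPiSubtypeProd (· ∈ T) C).symm (t, s) i =
      (Equiv.piEquivPiSubtypeProd (· ∈ T) C).symm (t', s') i) ↔ t = t' := by
  constructor
  · intro h
    ext ⟨i, hi⟩
    simpa [Equiv.piEquivPiSubtypeProd, hi] using h i hi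
  · rintro rfl i hi
    simp [Equiv.piEquivPiSubtypeProd, hi]

theorem glue_eq_off {T : Finset (Fin m)} (t t' : ∀ i : {i // i ∈ T}, C i)
    (s s' : ∀ i : {i // i ∉ T}, C i) :
    (∀ i ∈ Finset.univ \ T, (Equiv.piEquivPiSubtypeProd (· ∈ T) C).symm (t, s) i =
      (Equiv.piEquivPiSubtypeProd (· ∈ T) C).symm (t', s') i) ↔ s = s' := by
  constructor
  · intro h
    ext ⟨i, hi⟩
    simpa [Equiv.piEquivPiSubtypeProd, hi] using h i (by simpa using hi)
  · rintro rfl i hi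
    have hi' : i ∉ T := by simpa using hi
    simp [Equiv.piEquivPiSubtypeProd, hi']

variable [∀ i, Fintype (C i)]

/-- Number of measurement outcomes of all senders. -/
noncomputable def outcomeCard (C : Fin m → Type*) [∀ i, Fintype (C i)] (K L : Fin m → ℕ) : ℝ :=
  ∏ i, (8 : ℝ) ^ Fintype.card (Fin (L i) × (C i × Fin (K i)))

theorem outcomeCard_pos : 0 < outcomeCard C K L := Finset.prod_pos fun _ _ => by positivity

/-- Squared Hilbert–Schmidt norm of the partial trace of `ρ` over the senders outside `T`. -/
noncomputable def partialHsSq (ρ : (∀ i, C i) → (∀ i, C i) → ℂ) (T : Finset (Fin m)) : ℝ :=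
  ∑ t, ∑ t', ‖∑ s, ρ ((Equiv.piEquivPiSubtypeProd (· ∈ T) C).symm (t, s))
    ((Equiv.piEquivPiSubtypeProd (· ∈ T) C).symm (t', s))‖ ^ 2

theorem sum_pi_eq_sum_sum {M : Type*} [AddCommMonoid M] (T : Finset (Fin m))
    (F : (∀ i, C i) → M) :
    ∑ y, F y = ∑ t, ∑ s, F ((Equiv.piEquivPiSubtypeProd (· ∈ T) C).symm (t, s)) := by
  rw [← Equiv.sum_comp (Equiv.piEquivPiSubtypeProd (· ∈ T) C).symm, Fintype.sum_prod_type]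

variable [∀ i, DecidableEq (C i)]

theorem card_outcome : (Fintype.card (∀ i, Outcome C K L i) : ℝ) = outcomeCard C K L := by
  rw [Fintype.card_pi]
  simp [outcomeCard]

/-- Image of an operator on `C_M` under the random measurement with outcome `ω`. -/
noncomputable def transfer (ω : ∀ i, Outcome C K L i) (ρ : (∀ i, C i) → (∀ i, C i) → ℂ)
    (x x' : SenderOut L) : ℂ :=
  ∑ y, ∑ y', (∏ i, transferCoeff (ω i) (x i) (x' i) (y i) (y' i)) * ρ y y'

theorem prod_indicator_mul {ι : Type*} (s : Finset ι) (f : ι → ℂ) (p q : ι → Prop)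
    [DecidablePred p] [DecidablePred q] [Decidable (∀ i ∈ s, p i)] [Decidable (∀ i ∈ s, q i)] :
    ∏ i ∈ s, (f i * ((if p i then 1 else 0) * (if q i then 1 else 0))) =
      (∏ i ∈ s, f i) * ((if ∀ i ∈ s, p i then 1 else 0) * (if ∀ i ∈ s, q i then 1 else 0)) := by
  rw [Finset.prod_mul_distrib, Finset.prod_mul_distrib, Finset.prod_ite_zero,
    Finset.prod_ite_zero]
  simp

/-- The mean is already decoupled, so only the fluctuation around it remains to be controlled. -/
theorem sum_transfer (ρ : (∀ i, C i) → (∀ i, C i) → ℂ) (x x' : SenderOut L) :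
    ∑ ω : ∀ i, Outcome C K L i, transfer ω ρ x x' =
      outcomeCard C K L * ((∏ i, (K i : ℂ)) * ((if x = x' then 1 else 0) * ∑ y, ρ y y)) := by
  unfold transfer
  rw [Finset.sum_comm]
  simp only [Finset.sum_comm (s := (Finset.univ : Finset (∀ i, Outcome C K L i))),
    ← Finset.sum_mul]
  have h : ∀ y y' : ∀ i, C i, ∑ ω : ∀ i, Outcome C K L i,
      ∏ i, transferCoeff (ω i) (x i) (x' i) (y i) (y' i) =
      outcomeCard C K L * ((∏ i, (K i : ℂ)) *
        ((if x = x' then 1 else 0) * (if y = y' then 1 else 0))) := by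
    intro y y'
    rw [← Fintype.prod_sum (fun i f => transferCoeff f (x i) (x' i) (y i) (y' i))]
    simp only [sum_transferCoeff]
    rw [prod_indicator_mul, Finset.prod_mul_distrib]
    simp [outcomeCard, funext_iff]
  simp only [h]
  by_cases hx : x = x' <;> simp [hx, mul_assoc, ← Finset.mul_sum]

-- Indices in T are matched between the two copies of ρ, producing a Hilbert–Schmidt norm; those
-- outside T are matched within each copy, producing a partial trace.
open Classical in
theorem sum_indicator_eq_partialHsSq (ρ : (∀ i, C i) → (∀ i, C i) → ℂ) (T : Finset (Fin m)) :
    ∑ y : ∀ i, C i, ∑ y', ∑ w : ∀ i, C i, ∑ w',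
      (((if ∀ i ∈ T, y i = w i then 1 else 0) * (if ∀ i ∈ T, y' i = w' i then 1 else 0)) *
        ((if ∀ i ∈ Finset.univ \ T, y i = y' i then 1 else 0) *
          (if ∀ i ∈ Finset.univ \ T, w i = w' i then 1 else 0))) * (ρ y y' * star (ρ w w')) =
      (partialHsSq ρ T : ℂ) := by
  simp only [sum_pi_eq_sum_sum T, glue_eq_on, glue_eq_off]
  unfold partialHsSq
  push_cast
  refine Finset.sum_congr rfl fun t _ => ?_
  rw [Finset.sum_comm]
  refine Finset.sum_congr rfl fun t' _ => ?_
  rw [← Complex.mul_conj', map_sum, Finset.sum_mul_sum]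
  refine Finset.sum_congr rfl fun s _ => ?_
  have e : ∀ s' t₂ s₂ t₂' s₂',
      (((if t = t₂ then 1 else 0) * (if t' = t₂' then 1 else 0)) *
        ((if s = s' then 1 else 0) * (if s₂ = s₂' then 1 else 0))) *
        (ρ ((Equiv.piEquivPiSubtypeProd (· ∈ T) C).symm (t, s))
          ((Equiv.piEquivPiSubtypeProd (· ∈ T) C).symm (t', s')) *
        star (ρ ((Equiv.piEquivPiSubtypeProd (· ∈ T) C).symm (t₂, s₂))
          ((Equiv.piEquivPiSubtypeProd (· ∈ T) C).symm (t₂', s₂')))) =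
      if s = s' then (if t = t₂ then (if t' = t₂' then (if s₂ = s₂' then
        (ρ ((Equiv.piEquivPiSubtypeProd (· ∈ T) C).symm (t, s))
          ((Equiv.piEquivPiSubtypeProd (· ∈ T) C).symm (t', s')) *
        star (ρ ((Equiv.piEquivPiSubtypeProd (· ∈ T) C).symm (t₂, s₂))
          ((Equiv.piEquivPiSubtypeProd (· ∈ T) C).symm (t₂', s₂')))) else 0) else 0) else 0)
            else 0 := by
    intro s' t₂ s₂ t₂' s₂'
    split_ifs <;> simp
  simp only [e]
  have e1 : ∀ s', (∑ t₂, ∑ s₂, ∑ t₂', ∑ s₂', if s = s' then (if t = t₂ then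
      (if t' = t₂' then (if s₂ = s₂' then
        (ρ ((Equiv.piEquivPiSubtypeProd (· ∈ T) C).symm (t, s))
          ((Equiv.piEquivPiSubtypeProd (· ∈ T) C).symm (t', s')) *
        star (ρ ((Equiv.piEquivPiSubtypeProd (· ∈ T) C).symm (t₂, s₂))
          ((Equiv.piEquivPiSubtypeProd (· ∈ T) C).symm (t₂', s₂')))) else 0) else 0) else 0)
            else 0) = if s = s' then ∑ s₂,
        (ρ ((Equiv.piEquivPiSubtypeProd (· ∈ T) C).symm (t, s))
          ((Equiv.piEquivPiSubtypeProd (· ∈ T) C).symm (t', s')) *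
        star (ρ ((Equiv.piEquivPiSubtypeProd (· ∈ T) C).symm (t, s₂))
          ((Equiv.piEquivPiSubtypeProd (· ∈ T) C).symm (t', s₂)))) else 0 := by
    intro s'
    by_cases hs : s = s'
    · simp only [if_pos hs]
      rw [Finset.sum_eq_single t (fun t₂ _ h => by simp [Ne.symm h]) (by simp)]
      refine Finset.sum_congr rfl fun s₂ _ => ?_
      rw [Finset.sum_eq_single t' (fun t₂ _ h => by simp [Ne.symm h]) (by simp)]
      simp
    · simp [hs]
  simp only [e1, Finset.sum_ite_eq, Finset.mem_univ, if_true]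
  rfl

theorem sum_prod_three {ι : Type*} [Fintype ι] [DecidableEq ι] {α β γ : ι → Type*}
    [∀ i, Fintype (α i)] [∀ i, Fintype (β i)] [∀ i, Fintype (γ i)]
    (F : ∀ i, α i → β i → γ i → ℂ) :
    ∑ a : ∀ i, α i, ∑ b : ∀ i, β i, ∑ c : ∀ i, γ i, ∏ i, F i (a i) (b i) (c i) =
      ∏ i, ∑ a, ∑ b, ∑ c, F i a b c := by
  rw [Fintype.prod_sum]
  refine Finset.sum_congr rfl fun a _ => ?_
  rw [Fintype.prod_sum]
  refine Finset.sum_congr rfl fun b _ => ?_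
  rw [Fintype.prod_sum]

theorem sum_comm_three_four {α β γ : Type*} [Fintype α] [Fintype β] [Fintype γ]
    (f : α → β → β → γ → γ → γ → γ → ℂ) :
    ∑ a, ∑ b, ∑ b', ∑ y, ∑ y', ∑ w, ∑ w', f a b b' y y' w w' =
      ∑ y, ∑ y', ∑ w, ∑ w', ∑ a, ∑ b, ∑ b', f a b b' y y' w w' := by
  have := Finset.sum_comm (s := (Finset.univ : Finset (α × β × β)))
    (t := (Finset.univ : Finset (γ × γ × γ × γ)))
    (f := fun p q => f p.1 p.2.1 p.2.2 q.1 q.2.1 q.2.2.1 q.2.2.2)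
  simpa only [Fintype.sum_prod_type] using this

/-- Independence of the senders gives a product of two-term sums; in its expansion T is the set of
senders contributing the L²K pairing. -/
theorem sum_transfer_mul_star (ρ : (∀ i, C i) → (∀ i, C i) → ℂ) :
    ∑ ω : ∀ i, Outcome C K L i, ∑ x, ∑ x', ‖transfer ω ρ x x'‖ ^ 2 =
      outcomeCard C K L * ∑ T : Finset (Fin m), (∏ i ∈ T, ((L i : ℝ) ^ 2 * K i)) *
        (∏ i ∈ Finset.univ \ T, ((L i : ℝ) * K i ^ 2)) * partialHsSq ρ T := by
  classical
  rw [← Complex.ofReal_inj]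
  push_cast
  have h1 : ∀ (ω : ∀ i, Outcome C K L i) (x x' : SenderOut L),
      (‖transfer ω ρ x x'‖ : ℂ) ^ 2 = ∑ y, ∑ y', ∑ w, ∑ w',
        (∏ i, (transferCoeff (ω i) (x i) (x' i) (y i) (y' i) *
          star (transferCoeff (ω i) (x i) (x' i) (w i) (w' i)))) * (ρ y y' * star (ρ w w')) := by
    intro ω x x'
    rw [← Complex.mul_conj', transfer, Finset.sum_mul]
    refine Finset.sum_congr rfl fun y _ => ?_
    rw [Finset.sum_mul]
    refine Finset.sum_congr rfl fun y' _ => ?_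
    rw [map_sum, Finset.mul_sum]
    refine Finset.sum_congr rfl fun w _ => ?_
    rw [map_sum, Finset.mul_sum]
    refine Finset.sum_congr rfl fun w' _ => ?_
    rw [map_mul, map_prod, Finset.prod_mul_distrib]
    simp only [Complex.star_def]
    ring
  have h2 : ∀ (y y' w w' : ∀ i, C i), ∑ ω : ∀ i, Outcome C K L i, ∑ x : SenderOut L,
      ∑ x' : SenderOut L, ∏ i, (transferCoeff (ω i) (x i) (x' i) (y i) (y' i) *
          star (transferCoeff (ω i) (x i) (x' i) (w i) (w' i))) =
      outcomeCard C K L * ∑ T : Finset (Fin m), ((∏ i ∈ T, ((L i : ℂ) ^ 2 * K i)) *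
        (∏ i ∈ Finset.univ \ T, ((L i : ℂ) * K i ^ 2))) *
      (((if ∀ i ∈ T, y i = w i then 1 else 0) * (if ∀ i ∈ T, y' i = w' i then 1 else 0)) *
        ((if ∀ i ∈ Finset.univ \ T, y i = y' i then 1 else 0) *
          (if ∀ i ∈ Finset.univ \ T, w i = w' i then 1 else 0))) := by
    intro y y' w w'
    rw [sum_prod_three (fun i (f : Outcome C K L i) x x' => transferCoeff f x x' (y i) (y' i) *
      star (transferCoeff f x x' (w i) (w' i)))]
    simp only [sum_transferCoeff_mul_star]
    rw [Finset.prod_mul_distrib, Finset.prod_add, Finset.powerset_univ]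
    congr 1
    · simp [outcomeCard]
    · refine Finset.sum_congr rfl fun T _ => ?_
      rw [prod_indicator_mul, prod_indicator_mul]
      simp only [Fintype.card_fin]
      ring
  simp only [h1]
  rw [sum_comm_three_four]
  simp only [← Finset.sum_mul, h2]
  simp only [Finset.mul_sum, Finset.sum_mul]
  have h3 : ∀ T : Finset (Fin m), ∑ y : ∀ i, C i, ∑ y' : ∀ i, C i, ∑ w : ∀ i, C i, ∑ w' : ∀ i, C i,
      (outcomeCard C K L : ℂ) * (((∏ i ∈ T, ((L i : ℂ) ^ 2 * K i)) *
        (∏ i ∈ Finset.univ \ T, ((L i : ℂ) * K i ^ 2))) *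
      (((if ∀ i ∈ T, y i = w i then 1 else 0) * (if ∀ i ∈ T, y' i = w' i then 1 else 0)) *
        ((if ∀ i ∈ Finset.univ \ T, y i = y' i then 1 else 0) *
          (if ∀ i ∈ Finset.univ \ T, w i = w' i then 1 else 0)))) * (ρ y y' * star (ρ w w')) =
      (outcomeCard C K L : ℂ) * (((∏ i ∈ T, ((L i : ℂ) ^ 2 * K i)) *
        (∏ i ∈ Finset.univ \ T, ((L i : ℂ) * K i ^ 2))) * partialHsSq ρ T) := by
    intro T
    rw [← sum_indicator_eq_partialHsSq]
    simp only [Finset.mul_sum]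
    refine Finset.sum_congr rfl fun y _ => Finset.sum_congr rfl fun y' _ =>
      Finset.sum_congr rfl fun w _ => Finset.sum_congr rfl fun w' _ => ?_
    ring
  rw [← Finset.sum_congr rfl fun T _ => h3 T]
  have := Finset.sum_comm
    (s := (Finset.univ : Finset ((∀ i, C i) × (∀ i, C i) × (∀ i, C i) × (∀ i, C i))))
    (t := (Finset.univ : Finset (Finset (Fin m))))
    (f := fun q T => (outcomeCard C K L : ℂ) * (((∏ i ∈ T, ((L i : ℂ) ^ 2 * K i)) *
        (∏ i ∈ Finset.univ \ T, ((L i : ℂ) * K i ^ 2))) *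
      (((if ∀ i ∈ T, q.1 i = q.2.2.1 i then 1 else 0) *
        (if ∀ i ∈ T, q.2.1 i = q.2.2.2 i then 1 else 0)) *
        ((if ∀ i ∈ Finset.univ \ T, q.1 i = q.2.1 i then 1 else 0) *
          (if ∀ i ∈ Finset.univ \ T, q.2.2.1 i = q.2.2.2 i then 1 else 0)))) *
        (ρ q.1 q.2.1 * star (ρ q.2.2.1 q.2.2.2)))
  simpa only [Fintype.sum_prod_type] using this

end ManySenders

/-! ### The decoupling identity. -/

section Decoupling

variable {m : ℕ} {C : Fin m → Type*} {B R : Type*} {K L : Fin m → ℕ}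
  [∀ i, Fintype (C i)] [Fintype B]

/-- The block of the reduced state on `C_M R` between two basis vectors of `R`. -/
noncomputable def blockCM (ψ : (∀ i, C i) × B × R → ℂ) (r r' : R) (y y' : ∀ i, C i) : ℂ :=
  ∑ b, ψ (y, b, r) * star (ψ (y', b, r'))

theorem reducedTR_pureState_apply (ψ : (∀ i, C i) × B × R → ℂ) (T : Finset (Fin m))
    (t t' : ∀ i : {i // i ∈ T}, C i) (r r' : R) :
    reducedTR (pureState ψ) T (t, r) (t', r') =
      ∑ s, blockCM ψ r r' ((Equiv.piEquivPiSubtypeProd (· ∈ T) C).symm (t, s))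
        ((Equiv.piEquivPiSubtypeProd (· ∈ T) C).symm (t', s)) := by
  simp [reducedTR, traceFst, pureState, vecMulVec_apply, blockCM, Fintype.sum_prod_type]

theorem reducedR_pureState_apply (ψ : (∀ i, C i) × B × R → ℂ) (r r' : R) :
    reducedR (pureState ψ) r r' = ∑ y, blockCM ψ r r' y y := by
  simp only [reducedR, traceFst, pureState, vecMulVec_apply, blockCM, Matrix.of_apply]
  rw [Finset.sum_comm]
  rfl

theorem sum_partialHsSq [Fintype R] (ψ : (∀ i, C i) × B × R → ℂ) (T : Finset (Fin m)) :
    ∑ r, ∑ r', partialHsSq (blockCM ψ r r') T = hsSq (reducedTR (pureState ψ) T) := by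
  unfold hsSq partialHsSq
  simp only [Fintype.sum_prod_type, reducedTR_pureState_apply]
  conv_rhs => rw [Finset.sum_comm]
  refine Finset.sum_congr rfl fun r _ => ?_
  rw [Finset.sum_comm]
  refine Finset.sum_congr rfl fun t _ => ?_
  rw [Finset.sum_comm]

theorem partialHsSq_empty (ρ : (∀ i, C i) → (∀ i, C i) → ℂ) :
    partialHsSq ρ ∅ = ‖∑ y, ρ y y‖ ^ 2 := by
  have : IsEmpty {i : Fin m // i ∈ (∅ : Finset (Fin m))} :=
    ⟨fun i => absurd i.2 (Finset.notMem_empty _)⟩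
  rw [partialHsSq, sum_pi_eq_sum_sum ∅ (fun y => ρ y y)]
  simp only [Fintype.sum_unique]

/-- The unnormalized pure state of `C¹_M R` and `B B⁰_M` after the outcome `ω`. -/
noncomputable def outcomeMat (ω : ∀ i, Outcome C K L i) (ψ : (∀ i, C i) × B × R → ℂ) :
    Matrix (SenderOut L × R) (ReceiverIn B K) ℂ :=
  Matrix.of fun x y => ∑ c, (∏ i, sample (ω i (x.1 i, (c i, y.2 i)))) * ψ (c, y.1, x.2)

theorem outcomeMat_mul_conjTranspose (ω : ∀ i, Outcome C K L i) (ψ : (∀ i, C i) × B × R → ℂ)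
    (x x' : SenderOut L) (r r' : R) :
    (outcomeMat ω ψ * (outcomeMat ω ψ)ᴴ) (x, r) (x', r') =
      transfer ω (blockCM ψ r r') x x' := by
  have h : ∀ y y' : ∀ i, C i, ∏ i, transferCoeff (ω i) (x i) (x' i) (y i) (y' i) =
      ∑ k : ∀ i, Fin (K i), (∏ i, sample (ω i (x i, (y i, k i)))) *
        star (∏ i, sample (ω i (x' i, (y' i, k i)))) := by
    intro y y'
    unfold transferCoeff
    rw [Fintype.prod_sum]
    simp only [Finset.prod_mul_distrib, star_prod]
  simp only [Matrix.mul_apply, transfer, h, blockCM, conjTranspose_apply, outcomeMat,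
    Matrix.of_apply, star_sum, Finset.sum_mul_sum, Fintype.sum_prod_type]
  have := Finset.sum_comm (s := (Finset.univ : Finset (B × (∀ i, Fin (K i)))))
    (t := (Finset.univ : Finset ((∀ i, C i) × (∀ i, C i))))
    (f := fun q p => (∏ i, sample (ω i (x i, (p.1 i, q.2 i)))) * ψ (p.1, q.1, r) *
      star ((∏ i, sample (ω i (x' i, (p.2 i, q.2 i)))) * ψ (p.2, q.1, r')))
  simp only [Fintype.sum_prod_type] at this
  rw [this]
  refine Finset.sum_congr rfl fun y _ => Finset.sum_congr rfl fun y' _ => ?_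
  rw [Finset.sum_comm]
  refine Finset.sum_congr rfl fun k _ => Finset.sum_congr rfl fun b _ => ?_
  rw [star_mul']
  ring

/-- The variance identity, with μ the mean of f. -/
theorem sum_norm_sub_sq {ι : Type*} [Fintype ι] (f : ι → ℂ) (μ : ℂ)
    (h : ∑ j, f j = Fintype.card ι * μ) :
    ∑ j, ‖f j - μ‖ ^ 2 = ∑ j, ‖f j‖ ^ 2 - Fintype.card ι * ‖μ‖ ^ 2 := by
  rw [← Complex.ofReal_inj]
  push_cast
  simp only [← Complex.mul_conj', map_sub, sub_mul, mul_sub, Finset.sum_sub_distrib,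
    ← Finset.sum_mul, ← Finset.mul_sum, ← map_sum, h]
  simp
  ring

variable [∀ i, DecidableEq (C i)]

/-- The total variance of the outcome's reduced state: an exact identity, since second and fourth
moments are known exactly. -/
theorem sum_hsSq_outcomeMat_sub [Fintype R] (ψ : (∀ i, C i) × B × R → ℂ) :
    ∑ ω : ∀ i, Outcome C K L i, hsSq (outcomeMat ω ψ * (outcomeMat ω ψ)ᴴ -
        (∏ i, (K i : ℂ)) • ((1 : Matrix (SenderOut L) (SenderOut L) ℂ) ⊗ₖ
          reducedR (pureState ψ))) =
      outcomeCard C K L * ∑ T ∈ Finset.univ.filter (fun T : Finset (Fin m) => T.Nonempty),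
        (∏ i ∈ T, ((L i : ℝ) ^ 2 * K i)) * (∏ i ∈ Finset.univ \ T, ((L i : ℝ) * K i ^ 2)) *
          hsSq (reducedTR (pureState ψ) T) := by
  have h1 : ∀ r r', ∑ ω : ∀ i, Outcome C K L i, ∑ x, ∑ x', ‖transfer ω (blockCM ψ r r') x x' -
      (∏ i, (K i : ℂ)) * ((if x = x' then 1 else 0) * reducedR (pureState ψ) r r')‖ ^ 2 =
      outcomeCard C K L * ∑ T ∈ Finset.univ.filter (fun T : Finset (Fin m) => T.Nonempty),
        (∏ i ∈ T, ((L i : ℝ) ^ 2 * K i)) * (∏ i ∈ Finset.univ \ T, ((L i : ℝ) * K i ^ 2)) *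
          partialHsSq (blockCM ψ r r') T := by
    intro r r'
    have e1 : ∀ x x' : SenderOut L, ∑ ω : ∀ i, Outcome C K L i,
        ‖transfer ω (blockCM ψ r r') x x' -
          (∏ i, (K i : ℂ)) * ((if x = x' then 1 else 0) * reducedR (pureState ψ) r r')‖ ^ 2 =
        ∑ ω : ∀ i, Outcome C K L i, ‖transfer ω (blockCM ψ r r') x x'‖ ^ 2 -
          outcomeCard C K L * ((if x = x' then 1 else 0) *
            ((∏ i, (K i : ℝ)) ^ 2 * ‖reducedR (pureState ψ) r r'‖ ^ 2)) := by
      intro x x'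
      rw [sum_norm_sub_sq, card_outcome]
      · by_cases h : x = x' <;> simp [h, mul_pow]
      · rw [sum_transfer, ← reducedR_pureState_apply, ← card_outcome]
        push_cast
        rfl
    have e2 : ∑ ω : ∀ i, Outcome C K L i, ∑ x, ∑ x', ‖transfer ω (blockCM ψ r r') x x' -
      (∏ i, (K i : ℂ)) * ((if x = x' then 1 else 0) * reducedR (pureState ψ) r r')‖ ^ 2 =
      ∑ ω : ∀ i, Outcome C K L i, ∑ x, ∑ x', ‖transfer ω (blockCM ψ r r') x x'‖ ^ 2 -
        outcomeCard C K L * ((∏ i, (L i : ℝ)) *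
            ((∏ i, (K i : ℝ)) ^ 2 * ‖reducedR (pureState ψ) r r'‖ ^ 2)) := by
      rw [Finset.sum_comm]
      simp only [Finset.sum_comm (s := (Finset.univ : Finset (∀ i, Outcome C K L i))), e1,
        Finset.sum_sub_distrib]
      congr 1
      simp only [← Finset.mul_sum, ← Finset.sum_mul]
      congr 2
      simp
    rw [e2, sum_transfer_mul_star, ← mul_sub]
    congr 1
    -- The empty subset carries the weight ∏ L_i K_i² and is exactly the subtracted squared mean.
    have e3 : (Finset.univ.filter (fun T : Finset (Fin m) => T.Nonempty)) =
        Finset.univ.erase ∅ := by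
      ext T
      simp [Finset.nonempty_iff_ne_empty]
    rw [e3, ← Finset.add_sum_erase _ _ (Finset.mem_univ (∅ : Finset (Fin m))), partialHsSq_empty,
      ← reducedR_pureState_apply]
    simp only [Finset.prod_empty, Finset.sdiff_empty, Finset.prod_mul_distrib, Finset.prod_pow]
    ring
  have h2 : ∀ ω : ∀ i, Outcome C K L i, hsSq (outcomeMat ω ψ * (outcomeMat ω ψ)ᴴ -
        (∏ i, (K i : ℂ)) • ((1 : Matrix (SenderOut L) (SenderOut L) ℂ) ⊗ₖ
          reducedR (pureState ψ))) =
      ∑ r, ∑ r', ∑ x, ∑ x', ‖transfer ω (blockCM ψ r r') x x' -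
      (∏ i, (K i : ℂ)) * ((if x = x' then 1 else 0) * reducedR (pureState ψ) r r')‖ ^ 2 := by
    intro ω
    unfold hsSq
    simp only [Fintype.sum_prod_type, Matrix.sub_apply, outcomeMat_mul_conjTranspose,
      Matrix.smul_apply, kroneckerMap_apply, Matrix.one_apply, smul_eq_mul]
    rw [Finset.sum_comm]
    refine Finset.sum_congr rfl fun r _ => ?_
    conv_rhs => rw [Finset.sum_comm]
    refine Finset.sum_congr rfl fun x _ => ?_
    rw [Finset.sum_comm]
  simp only [h2]
  rw [Finset.sum_comm]
  simp only [Finset.sum_comm (s := (Finset.univ : Finset (∀ i, Outcome C K L i)))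
    (t := (Finset.univ : Finset R)), h1, ← sum_partialHsSq]
  simp only [Finset.mul_sum]
  conv_rhs => rw [Finset.sum_comm]
  refine Finset.sum_congr rfl fun r _ => ?_
  conv_rhs => rw [Finset.sum_comm]

end Decoupling

/-! ### Removing the weight ψ^R, and the min-entropy. -/

section Whitening

theorem posSemidef_trace_smul_sub {n : Type*} [Fintype n] [DecidableEq n] {P : Matrix n n ℂ}
    (hP : P.PosSemidef) : (P.trace.re • (1 : Matrix n n ℂ) - P).PosSemidef := by
  have ht : P.trace.re = ∑ i, hP.1.eigenvalues i := by
    conv_lhs => rw [← spectralMap_id hP.1, trace_spectralMap]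
    simp
  have e : P.trace.re • (1 : Matrix n n ℂ) - P =
      spectralMap hP.1 (fun x => P.trace.re - x) := by
    rw [← spectralMap_sub, spectralMap_id]
    congr 1
    have h2 : spectralMap hP.1 (fun _ => P.trace.re) = P.trace.re • (1 : Matrix n n ℂ) := by
      rw [← spectralMap_one hP.1]
      unfold spectralMap
      rw [← Matrix.smul_mul, ← Matrix.mul_smul]
      congr 2
      ext i j
      simp [diagonal_apply, Matrix.one_apply]
    rw [h2]
  rw [e]
  refine spectralMap_posSemidef _ fun i => ?_
  rw [sub_nonneg, ht]
  exact Finset.single_le_sum (fun j _ => hP.eigenvalues_nonneg j) (Finset.mem_univ i)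

variable {m : ℕ} {C : Fin m → Type*} {B R : Type*} {K L : Fin m → ℕ}

/-- The vector `(I ⊗ t)|ψ⟩` for an operator `t` on `R`. -/
noncomputable def applyR [Fintype R] (t : Matrix R R ℂ) (ψ : (∀ i, C i) × B × R → ℂ) :
    (∀ i, C i) × B × R → ℂ :=
  fun x => ∑ r, t x.2.2 r * ψ (x.1, x.2.1, r)

theorem applyR_mul [Fintype R] (t u : Matrix R R ℂ) (ψ : (∀ i, C i) × B × R → ℂ) :
    applyR (t * u) ψ = applyR t (applyR u ψ) := by
  ext x
  simp only [applyR, Matrix.mul_apply, Finset.sum_mul, Finset.mul_sum]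
  rw [Finset.sum_comm]
  simp only [mul_assoc]

/-- A state as a matrix from the senders outside `T` and the receiver to `𝒯 R`. -/
def splitMat (ψ : (∀ i, C i) × B × R → ℂ) (T : Finset (Fin m)) :
    Matrix ((∀ i : {i // i ∈ T}, C i) × R) ((∀ i : {i // i ∉ T}, C i) × B) ℂ :=
  Matrix.of fun x y =>
    ψ ((Equiv.piEquivPiSubtypeProd (· ∈ T) C).symm (x.1, y.1), y.2, x.2)

/-- A state as a matrix from the senders and the receiver to `R`. -/
def refMat (ψ : (∀ i, C i) × B × R → ℂ) : Matrix R ((∀ i, C i) × B) ℂ :=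
  Matrix.of fun r y => ψ (y.1, y.2, r)

theorem refMat_applyR [Fintype R] (t : Matrix R R ℂ) (ψ : (∀ i, C i) × B × R → ℂ) :
    refMat (applyR t ψ) = t * refMat ψ := by
  ext r y
  simp [refMat, applyR, Matrix.mul_apply]

theorem outcomeMat_applyR [∀ i, Fintype (C i)] [Fintype R] (ω : ∀ i, Outcome C K L i)
    (t : Matrix R R ℂ) (ψ : (∀ i, C i) × B × R → ℂ) :
    outcomeMat ω (applyR t ψ) =
      ((1 : Matrix (SenderOut L) (SenderOut L) ℂ) ⊗ₖ t) * outcomeMat ω ψ := by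
  ext ⟨x, r⟩ ⟨b, k⟩
  simp only [outcomeMat, applyR, Matrix.mul_apply, Matrix.of_apply, Fintype.sum_prod_type,
    kroneckerMap_apply, Matrix.one_apply, ite_mul, one_mul, zero_mul, Finset.mul_sum]
  rw [Finset.sum_eq_single x (fun x' _ h => by simp [Ne.symm h]) (by simp)]
  simp only [if_true]
  rw [Finset.sum_comm]
  refine Finset.sum_congr rfl fun _ _ => Finset.sum_congr rfl fun _ _ => ?_
  ring

theorem splitMat_applyR [∀ i, Fintype (C i)]
    [∀ i, DecidableEq (C i)] [Fintype R] (t : Matrix R R ℂ) (ψ : (∀ i, C i) × B × R → ℂ)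
    (T : Finset (Fin m)) :
    splitMat (applyR t ψ) T =
      ((1 : Matrix (∀ i : {i // i ∈ T}, C i) (∀ i : {i // i ∈ T}, C i) ℂ) ⊗ₖ t) *
        splitMat ψ T := by
  ext ⟨x, r⟩ y
  simp only [splitMat, applyR, Matrix.mul_apply, Matrix.of_apply, Fintype.sum_prod_type,
    kroneckerMap_apply, Matrix.one_apply, ite_mul, one_mul, zero_mul]
  rw [Finset.sum_eq_single x (fun x' _ h => by simp [Ne.symm h]) (by simp)]
  simp

variable [∀ i, Fintype (C i)] [Fintype B]

theorem reducedTR_eq (ψ : (∀ i, C i) × B × R → ℂ) (T : Finset (Fin m)) :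
    reducedTR (pureState ψ) T = splitMat ψ T * (splitMat ψ T)ᴴ := by
  ext ⟨t, r⟩ ⟨t', r'⟩
  rw [reducedTR_pureState_apply]
  simp [Matrix.mul_apply, splitMat, Fintype.sum_prod_type, blockCM]

theorem reducedR_eq (ψ : (∀ i, C i) × B × R → ℂ) :
    reducedR (pureState ψ) = refMat ψ * (refMat ψ)ᴴ := by
  ext r r'
  rw [reducedR_pureState_apply]
  simp [Matrix.mul_apply, refMat, Fintype.sum_prod_type, blockCM]

theorem sum_reducedTR (ψ : (∀ i, C i) × B × R → ℂ) (T : Finset (Fin m)) (r r' : R) :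
    ∑ t, reducedTR (pureState ψ) T (t, r) (t, r') = reducedR (pureState ψ) r r' := by
  simp only [reducedTR_pureState_apply, reducedR_pureState_apply]
  rw [← sum_pi_eq_sum_sum T (fun y => blockCM ψ r r' y y)]

variable [Fintype R]

theorem trace_reducedR (ψ : (∀ i, C i) × B × R → ℂ) :
    (reducedR (pureState ψ)).trace = (vecSq ψ : ℂ) := by
  rw [reducedR_eq, trace_mul_conjTranspose_self]
  congr 1
  simp only [hsSq, vecSq, refMat, Fintype.sum_prod_type, Matrix.of_apply]
  rw [Finset.sum_comm]
  refine Finset.sum_congr rfl fun y _ => ?_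
  rw [Finset.sum_comm]

variable [∀ i, DecidableEq (C i)]

theorem trace_reducedTR_mul (ψ : (∀ i, C i) × B × R → ℂ) (T : Finset (Fin m))
    (A : Matrix R R ℂ) :
    (reducedTR (pureState ψ) T *
      ((1 : Matrix (∀ i : {i // i ∈ T}, C i) (∀ i : {i // i ∈ T}, C i) ℂ) ⊗ₖ A)).trace =
      (reducedR (pureState ψ) * A).trace := by
  simp only [Matrix.trace, Matrix.diag_apply, Matrix.mul_apply, Fintype.sum_prod_type,
    kroneckerMap_apply, Matrix.one_apply, ite_mul, one_mul, zero_mul, mul_ite, mul_zero]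
  rw [Finset.sum_comm]
  refine Finset.sum_congr rfl fun r _ => ?_
  simp only [← sum_reducedTR ψ T, Finset.sum_mul]
  conv_rhs => rw [Finset.sum_comm]
  refine Finset.sum_congr rfl fun t _ => ?_
  rw [Finset.sum_eq_single t (fun x' _ h => by simp [h]) (by simp)]
  simp

variable [DecidableEq R] [DecidableEq B]

/-- Polar decomposition of ψ viewed as a matrix into R, with the partial isometry reread as a vector
φ. It replaces multiplication by an inverse of √ψ^R, which may be singular. -/
theorem exists_applyR_sqrt (ψ : (∀ i, C i) × B × R → ℂ) :
    ∃ (A : Matrix R R ℂ) (φ : (∀ i, C i) × B × R → ℂ), A.PosSemidef ∧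
      A * A = reducedR (pureState ψ) ∧ ψ = applyR A φ ∧ refMat φ * (refMat φ)ᴴ * A = A := by
  obtain ⟨A, W, hA, hAA, hAW, -, hWA, -⟩ := exists_polar (refMat ψ)
  refine ⟨A, fun x => W x.2.2 (x.1, x.2.1), hA, by rw [hAA, reducedR_eq], ?_, hWA⟩
  ext ⟨y, b, r⟩
  have := congrFun (congrFun hAW r) (y, b)
  simpa [refMat, Matrix.mul_apply, applyR] using this

/-- Removal of the weight `ψ^R` from a state: with `s⁴ = ψ^R`, the operator inequality
`ψ^{𝒯R} ≤ l (I ⊗ ψ^R)` bounds the purity on `𝒯R` of the vector `χ` with `ψ = (I ⊗ s) χ`. -/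
theorem exists_whitening (ψ : (∀ i, C i) × B × R → ℂ) (hψ : vecSq ψ = 1) :
    ∃ (s : Matrix R R ℂ) (χ : (∀ i, C i) × B × R → ℂ), s.IsHermitian ∧ ψ = applyR s χ ∧
      s * s * (s * s) = reducedR (pureState ψ) ∧ reducedR (pureState χ) = s * s ∧
      ∀ (T : Finset (Fin m)) (l : ℝ), (l • ((1 : Matrix (∀ i : {i // i ∈ T}, C i)
        (∀ i : {i // i ∈ T}, C i) ℂ) ⊗ₖ reducedR (pureState ψ)) -
          reducedTR (pureState ψ) T).PosSemidef → hsSq (reducedTR (pureState χ) T) ≤ l := by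
  obtain ⟨A, φ, hA, hAA, hψφ, hWA⟩ := exists_applyR_sqrt ψ
  obtain ⟨s, g, hs, hg, hss, hsg, hsgs, -, -, -⟩ := exists_sqrt_pinv hA
  have hssg : s * s * g = s := by rw [Matrix.mul_assoc, hsg, ← Matrix.mul_assoc, hsgs]
  have hgss : g * s * s = s := by rw [← hsg, hsgs]
  have hWs : refMat φ * (refMat φ)ᴴ * s = s := by
    conv_lhs => rw [← hssg, ← Matrix.mul_assoc, hss, hWA]
    rw [← hss, hssg]
  have hχR : reducedR (pureState (applyR s φ)) = s * s := by
    rw [reducedR_eq, refMat_applyR, conjTranspose_mul, hs.1.eq, Matrix.mul_assoc,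
      ← Matrix.mul_assoc (refMat φ), hWs]
  have hσ : s * s * (s * s) = reducedR (pureState ψ) := by rw [hss, hAA]
  refine ⟨s, applyR s φ, hs.1, by rw [← applyR_mul, hss]; exact hψφ, hσ, hχR, ?_⟩
  intro T l hl
  have hg1 : ((1 : Matrix (∀ i : {i // i ∈ T}, C i) (∀ i : {i // i ∈ T}, C i) ℂ) ⊗ₖ g)ᴴ =
      1 ⊗ₖ g := by
    rw [conjTranspose_kronecker, conjTranspose_one, hg.1.eq]
  -- This lets the operator inequality for ψ be carried to χ by conjugating with I ⊗ g, where g is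
  -- the pseudo-inverse of s.
  have hχ : applyR s φ = applyR g ψ := by
    rw [hψφ, ← hss, ← applyR_mul, ← Matrix.mul_assoc, hgss]
  have h1 : (l • ((1 : Matrix (∀ i : {i // i ∈ T}, C i) (∀ i : {i // i ∈ T}, C i) ℂ) ⊗ₖ (s * s))
      - reducedTR (pureState (applyR s φ)) T).PosSemidef := by
    have := hl.mul_mul_conjTranspose_same
      ((1 : Matrix (∀ i : {i // i ∈ T}, C i) (∀ i : {i // i ∈ T}, C i) ℂ) ⊗ₖ g)
    convert this using 1
    rw [Matrix.mul_sub, Matrix.sub_mul, Matrix.mul_smul, Matrix.smul_mul, hg1,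
      ← mul_kronecker_mul, ← mul_kronecker_mul, hχ, reducedTR_eq, splitMat_applyR,
      conjTranspose_mul, hg1, reducedTR_eq, ← hσ]
    have e : g * (s * s * (s * s)) * g = s * s := by
      calc g * (s * s * (s * s)) * g = (g * s * s) * (s * s * g) := by
            simp only [Matrix.mul_assoc]
        _ = s * s := by rw [hgss, hssg]
    rw [Matrix.one_mul, Matrix.one_mul, e]
    simp only [Matrix.mul_assoc]
  have hρ : (reducedTR (pureState (applyR s φ)) T).PosSemidef := by
    rw [reducedTR_eq]; exact posSemidef_self_mul_conjTranspose _
  -- Tracing against χ^{𝒯R} itself: Tr (χ^{𝒯R})² ≤ l Tr χ^{𝒯R}(I ⊗ s²) = l Tr s⁴ = l.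
  have h2 := re_trace_mul_nonneg hρ h1
  rw [Matrix.mul_sub, Matrix.mul_smul, trace_sub, trace_smul, trace_reducedTR_mul, hχR, hσ,
    trace_reducedR, hψ] at h2
  rw [hsSq_eq_re_trace, hρ.1.eq]
  simpa using h2

/-- Passes to the infimum of the admissible λ without showing that it is attained. The infimum must
be positive for the exponential to undo the logarithm. -/
theorem minEntropy_bound (ψ : (∀ i, C i) × B × R → ℂ) (hψ : vecSq ψ = 1) (T : Finset (Fin m))
    {h : ℝ} (hh : ∀ l : ℝ, (l • ((1 : Matrix (∀ i : {i // i ∈ T}, C i)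
        (∀ i : {i // i ∈ T}, C i) ℂ) ⊗ₖ reducedR (pureState ψ)) -
          reducedTR (pureState ψ) T).PosSemidef → h ≤ l) :
    h ≤ 2 ^ (-minEntropy (reducedTR (pureState ψ) T) (reducedR (pureState ψ))) := by
  set S : Set ℝ := {l : ℝ | 0 < l ∧ (l • ((1 : Matrix (∀ i : {i // i ∈ T}, C i)
        (∀ i : {i // i ∈ T}, C i) ℂ) ⊗ₖ reducedR (pureState ψ)) -
          reducedTR (pureState ψ) T).PosSemidef} with hS
  have hne : S.Nonempty := by
    obtain ⟨A, φ, hA, hAA, hψφ, -⟩ := exists_applyR_sqrt ψ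
    set P := splitMat φ T * (splitMat φ T)ᴴ with hP
    have hPp : P.PosSemidef := posSemidef_self_mul_conjTranspose _
    have hA1 : ((1 : Matrix (∀ i : {i // i ∈ T}, C i) (∀ i : {i // i ∈ T}, C i) ℂ) ⊗ₖ A)ᴴ =
        1 ⊗ₖ A := by
      rw [conjTranspose_kronecker, conjTranspose_one, hA.1.eq]
    have h1 := (posSemidef_trace_smul_sub hPp).add
      (Matrix.PosSemidef.one (n := (∀ i : {i // i ∈ T}, C i) × R) (R := ℂ))
    have h2 := h1.mul_mul_conjTranspose_same
      ((1 : Matrix (∀ i : {i // i ∈ T}, C i) (∀ i : {i // i ∈ T}, C i) ℂ) ⊗ₖ A)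
    -- A positive matrix is at most its trace times I; conjugating with I ⊗ √ψ^R makes the trace
    -- admissible, and the extra 1 makes the witness strictly positive.
    refine ⟨P.trace.re + 1, by linarith [re_trace_nonneg_of_posSemidef hPp], ?_⟩
    convert h2 using 1
    have e1 : reducedTR (pureState ψ) T = (1 ⊗ₖ A) * P * (1 ⊗ₖ A) := by
      rw [hψφ, reducedTR_eq, splitMat_applyR, conjTranspose_mul, hA1]
      simp only [hP, Matrix.mul_assoc]
    have e2 : (1 : Matrix (∀ i : {i // i ∈ T}, C i) (∀ i : {i // i ∈ T}, C i) ℂ) ⊗ₖ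
        reducedR (pureState ψ) = (1 ⊗ₖ A) * (1 ⊗ₖ A) := by
      rw [← mul_kronecker_mul, Matrix.one_mul, hAA]
    rw [e1, e2, hA1, Matrix.mul_add, Matrix.add_mul, Matrix.mul_sub, Matrix.sub_mul,
      Matrix.mul_smul, Matrix.smul_mul, Matrix.mul_one, add_smul, one_smul]
    abel
  -- Traces of the operator inequality give λd ≥ 1, so 1/d bounds the infimum below.
  have htr : ∀ l ∈ S, 1 ≤ l * Fintype.card (∀ i : {i // i ∈ T}, C i) := by
    rintro l ⟨-, hl⟩
    have h1 := re_trace_nonneg_of_posSemidef hl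
    have h2 := trace_reducedTR_mul ψ T 1
    rw [Matrix.mul_one, one_kronecker_one, Matrix.mul_one, trace_reducedR, hψ] at h2
    rw [trace_sub, trace_smul, trace_kronecker, trace_reducedR, hψ, h2, trace_one,
      Complex.ofReal_one, mul_one, Complex.sub_re, Complex.smul_re, Complex.natCast_re,
      Complex.one_re, smul_eq_mul] at h1
    linarith
  have hd : 0 < (Fintype.card (∀ i : {i // i ∈ T}, C i) : ℝ) := by
    obtain ⟨l, hl⟩ := hne
    have := htr l hl
    rcases Nat.eq_zero_or_pos (Fintype.card (∀ i : {i // i ∈ T}, C i)) with h0 | h0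
    · rw [h0] at this; norm_num at this
    · exact_mod_cast h0
  have hpos : 0 < sInf S := by
    refine lt_of_lt_of_le (one_div_pos.2 hd) (le_csInf hne fun l hl => ?_)
    rw [div_le_iff₀ hd]
    exact htr l hl
  rw [minEntropy, neg_neg, Real.rpow_logb (by norm_num) (by norm_num) hpos]
  exact le_csInf hne fun l hl => hh l hl.2

end Whitening

/-! ### Decoders and the average overlap. -/

section Decoders

variable {m : ℕ} {C : Fin m → Type*} {B R : Type*} {K L : Fin m → ℕ}

/-- Normalization of the outcome states. -/
noncomputable def outcomeNorm (C : Fin m → Type*) [∀ i, Fintype (C i)] (K L : Fin m → ℕ) : ℝ :=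
  (√(outcomeCard C K L * (∏ i, (L i : ℝ)) * ∏ i, (K i : ℝ)))⁻¹

/-- Normalization of the share of the target state in one outcome. -/
noncomputable def targetNorm (C : Fin m → Type*) [∀ i, Fintype (C i)] (K L : Fin m → ℕ) : ℝ :=
  (√(outcomeCard C K L))⁻¹

variable [∀ i, Fintype (C i)]

theorem prod_natCast_pos {K : Fin m → ℕ} (hK : ∀ i, 1 ≤ K i) : 0 < ∏ i, (K i : ℝ) :=
  Finset.prod_pos fun i _ => by exact_mod_cast hK i

theorem outcomeNorm_sq (hK : ∀ i, 1 ≤ K i) (hL : ∀ i, 1 ≤ L i) :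
    outcomeNorm C K L ^ 2 = (outcomeCard C K L * (∏ i, (L i : ℝ)) * ∏ i, (K i : ℝ))⁻¹ := by
  have h1 := prod_natCast_pos hK
  have h2 := prod_natCast_pos hL
  have h3 := outcomeCard_pos (C := C) (K := K) (L := L)
  rw [outcomeNorm, inv_pow, Real.sq_sqrt (by positivity)]

theorem targetNorm_sq : targetNorm C K L ^ 2 = (outcomeCard C K L)⁻¹ := by
  rw [targetNorm, inv_pow, Real.sq_sqrt outcomeCard_pos.le]

theorem hsSq_smul {a b : Type*} [Fintype a] [Fintype b] (x : ℝ) (A : Matrix a b ℂ) :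
    hsSq ((x : ℂ) • A) = x ^ 2 * hsSq A := by
  simp [hsSq, mul_pow, Finset.mul_sum]

theorem smul_mul_conjTranspose_smul {a b : Type*} [Fintype b] (x : ℝ) (A : Matrix a b ℂ) :
    ((x : ℂ) • A) * ((x : ℂ) • A)ᴴ = ((x ^ 2 : ℝ) : ℂ) • (A * Aᴴ) := by
  rw [conjTranspose_smul, Matrix.smul_mul, Matrix.mul_smul, smul_smul]
  congr 1
  simp [pow_two]

/-- Isolates the factor common to all T, which the normalization later cancels. -/
theorem weight_div (hK : ∀ i, 1 ≤ K i) (T : Finset (Fin m)) :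
    (∏ i ∈ T, ((L i : ℝ) ^ 2 * K i)) * (∏ i ∈ Finset.univ \ T, ((L i : ℝ) * K i ^ 2)) =
      (∏ i, (L i : ℝ)) * (∏ i, (K i : ℝ)) ^ 2 * ∏ i ∈ T, ((L i : ℝ) / K i) := by
  have h1 : ∀ f : Fin m → ℝ, ∏ i, f i = (∏ i ∈ T, f i) * ∏ i ∈ Finset.univ \ T, f i := by
    intro f
    rw [mul_comm, Finset.prod_sdiff (Finset.subset_univ T)]
  rw [h1 (fun i => (L i : ℝ)), h1 (fun i => (K i : ℝ))]
  have h2 : ∏ i ∈ T, ((L i : ℝ) ^ 2 * K i) =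
      (∏ i ∈ T, (L i : ℝ)) * (∏ i ∈ T, (K i : ℝ)) ^ 2 * ∏ i ∈ T, ((L i : ℝ) / K i) := by
    rw [← Finset.prod_pow, ← Finset.prod_mul_distrib, ← Finset.prod_mul_distrib]
    refine Finset.prod_congr rfl fun i _ => ?_
    have : (K i : ℝ) ≠ 0 := by have := hK i; positivity
    field_simp
  rw [h2, Finset.prod_mul_distrib, Finset.prod_pow]
  ring

variable [∀ i, DecidableEq (C i)] [Fintype B] [Fintype R]

/-- The outcome probabilities sum to one; this is the trace of the mean. -/
theorem sum_hsSq_outcomeMat (ψ : (∀ i, C i) × B × R → ℂ) (hψ : vecSq ψ = 1)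
    (hK : ∀ i, 1 ≤ K i) (hL : ∀ i, 1 ≤ L i) :
    ∑ ω : ∀ i, Outcome C K L i, hsSq ((outcomeNorm C K L : ℂ) • outcomeMat ω ψ) = 1 := by
  have hKp := prod_natCast_pos hK
  have hLp := prod_natCast_pos hL
  have hn := outcomeCard_pos (C := C) (K := K) (L := L)
  have h1 : ∑ ω : ∀ i, Outcome C K L i, (hsSq (outcomeMat ω ψ) : ℂ) =
      outcomeCard C K L * ((∏ i, (K i : ℂ)) * ∏ i, (L i : ℂ)) := by
    simp only [← trace_mul_conjTranspose_self, Matrix.trace, Matrix.diag_apply,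
      Fintype.sum_prod_type, outcomeMat_mul_conjTranspose]
    rw [Finset.sum_comm]
    simp only [Finset.sum_comm (s := (Finset.univ : Finset (∀ i, Outcome C K L i)))
      (t := (Finset.univ : Finset R)), sum_transfer, ← reducedR_pureState_apply]
    have h2 := trace_reducedR ψ
    rw [Matrix.trace, hψ] at h2
    simp only [Matrix.diag_apply] at h2
    simp only [if_true, one_mul, ← Finset.mul_sum, h2]
    simp
  have h3 : ∑ ω : ∀ i, Outcome C K L i, hsSq (outcomeMat ω ψ) =
      outcomeCard C K L * ((∏ i, (K i : ℝ)) * ∏ i, (L i : ℝ)) := by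
    exact_mod_cast h1
  simp only [hsSq_smul, ← Finset.mul_sum, h3, outcomeNorm_sq hK hL]
  field_simp

variable [DecidableEq B] [DecidableEq R]
  {Z : Type*} [Fintype Z] [DecidableEq Z]

/-- For each outcome a decoder exists, and on average the outcome states are decoded well. -/
theorem exists_decoders (ψ : (∀ i, C i) × B × R → ℂ) (hψ : vecSq ψ = 1)
    (hK : ∀ i, 1 ≤ K i) (hL : ∀ i, 1 ≤ L i) (N : Matrix (SenderOut L × R) Z ℂ)
    (hN : N * Nᴴ = (∏ i, (L i : ℂ))⁻¹ • ((1 : Matrix (SenderOut L) (SenderOut L) ℂ) ⊗ₖ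
      reducedR (pureState ψ))) :
    ∃ V : (∀ i, Outcome C K L i) → Matrix Z (ReceiverIn B K) ℂ,
      (∀ ω, (1 - (V ω)ᴴ * V ω).PosSemidef) ∧
      ∑ ω : ∀ i, Outcome C K L i, (hsSq ((outcomeNorm C K L : ℂ) • outcomeMat ω ψ) +
        hsSq ((targetNorm C K L : ℂ) • N) -
        2 * (((outcomeNorm C K L : ℂ) • outcomeMat ω ψ) * (V ω)ᵀ *
          ((targetNorm C K L : ℂ) • N)ᴴ).trace.re) ≤
      √(∑ T ∈ Finset.univ.filter (fun T : Finset (Fin m) => T.Nonempty),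
        (∏ i ∈ T, ((L i : ℝ) / K i)) *
          2 ^ (-minEntropy (reducedTR (pureState ψ) T) (reducedR (pureState ψ)))) := by
  obtain ⟨s, χ, hs, hψχ, hσ, hχ, hpur⟩ := exists_whitening ψ hψ
  choose V S hV hS hSS hle using fun ω : ∀ i, Outcome C K L i =>
    exists_contraction_overlap ((outcomeNorm C K L : ℂ) • outcomeMat ω ψ)
      ((targetNorm C K L : ℂ) • N)
  refine ⟨V, hV, (Finset.sum_le_sum fun ω _ => hle ω).trans ?_⟩
  have hKp := prod_natCast_pos hK
  have hLp := prod_natCast_pos hL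
  have hn := outcomeCard_pos (C := C) (K := K) (L := L)
  set n := outcomeCard C K L with hndef
  set s1 : Matrix (SenderOut L × R) (SenderOut L × R) ℂ := 1 ⊗ₖ s with hs1
  have hs1h : s1.IsHermitian := by
    rw [Matrix.IsHermitian, hs1, conjTranspose_kronecker, conjTranspose_one, hs.eq]
  set Y : (∀ i, Outcome C K L i) → Matrix (SenderOut L × R) (SenderOut L × R) ℂ :=
    fun ω => outcomeMat ω χ * (outcomeMat ω χ)ᴴ -
        (∏ i, (K i : ℂ)) • ((1 : Matrix (SenderOut L) (SenderOut L) ℂ) ⊗ₖ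
          reducedR (pureState χ)) with hY
  -- The normalizations are matched: `outcomeNorm` squared times ∏ K_i is `targetNorm` squared over
  -- ∏ L_i, so only the fluctuation for χ, conjugated by I ⊗ s, remains.
  have hdiff : ∀ ω, ((outcomeNorm C K L : ℂ) • outcomeMat ω ψ) *
      ((outcomeNorm C K L : ℂ) • outcomeMat ω ψ)ᴴ - ((targetNorm C K L : ℂ) • N) *
        ((targetNorm C K L : ℂ) • N)ᴴ =
      (((n * (∏ i, (L i : ℝ)) * ∏ i, (K i : ℝ))⁻¹ : ℝ) : ℂ) • (s1 * Y ω * s1) := by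
    intro ω
    have e1 : s1 * Y ω * s1 = outcomeMat ω ψ * (outcomeMat ω ψ)ᴴ -
        (∏ i, (K i : ℂ)) • ((1 : Matrix (SenderOut L) (SenderOut L) ℂ) ⊗ₖ
          reducedR (pureState ψ)) := by
      rw [hY, Matrix.mul_sub, Matrix.sub_mul, Matrix.mul_smul, Matrix.smul_mul, hχ, ← hσ]
      congr 1
      · conv_rhs => rw [hψχ, outcomeMat_applyR, conjTranspose_mul, hs1h.eq]
        simp only [hs1, Matrix.mul_assoc]
      · rw [hs1, ← mul_kronecker_mul, ← mul_kronecker_mul]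
        simp only [Matrix.mul_assoc, Matrix.one_mul]
    rw [smul_mul_conjTranspose_smul, smul_mul_conjTranspose_smul, hN, e1, outcomeNorm_sq hK hL,
      targetNorm_sq, smul_sub, smul_smul, smul_smul]
    congr 2
    push_cast
    have h1 : (∏ i, (K i : ℂ)) ≠ 0 := by exact_mod_cast hKp.ne'
    have h2 : (∏ i, (L i : ℂ)) ≠ 0 := by exact_mod_cast hLp.ne'
    have h3 : (outcomeCard C K L : ℂ) ≠ 0 := by exact_mod_cast hn.ne'
    rw [← hndef] at h3 ⊢
    field_simp
  have hs4 : (s1 * s1 * (s1 * s1)).trace.re = ∏ i, (L i : ℝ) := by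
    rw [hs1, ← mul_kronecker_mul, ← mul_kronecker_mul, hσ, Matrix.one_mul, Matrix.one_mul,
      trace_kronecker, trace_reducedR, hψ, trace_one, Complex.ofReal_one, mul_one,
      Complex.natCast_re, Fintype.card_pi]
    simp
  have hterm : ∀ ω, (S ω * (((outcomeNorm C K L : ℂ) • outcomeMat ω ψ) *
      ((outcomeNorm C K L : ℂ) • outcomeMat ω ψ)ᴴ - ((targetNorm C K L : ℂ) • N) *
        ((targetNorm C K L : ℂ) • N)ᴴ)).trace.re ≤
      (n * (∏ i, (L i : ℝ)) * ∏ i, (K i : ℝ))⁻¹ * √(∏ i, (L i : ℝ)) * √(hsSq (Y ω)) := by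
    intro ω
    rw [hdiff, Matrix.mul_smul, trace_smul, smul_eq_mul, Complex.re_ofReal_mul, mul_assoc (_)⁻¹]
    refine mul_le_mul_of_nonneg_left ?_ (by positivity)
    rw [← hs4]
    exact re_trace_mul_sandwich_le (hS ω) (hSS ω) hs1h (Y ω)
  refine (Finset.sum_le_sum fun ω _ => hterm ω).trans ?_
  rw [← Finset.mul_sum]
  -- Cauchy–Schwarz over the n outcomes moves the square root outside the sum, where the exact
  -- variance is available.
  have hcs : ∑ ω, √(hsSq (Y ω)) ≤ √n * √(∑ ω, hsSq (Y ω)) := by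
    have := Real.sum_mul_le_sqrt_mul_sqrt (Finset.univ : Finset (∀ i, Outcome C K L i))
      (fun _ => 1) (fun ω => √(hsSq (Y ω)))
    simpa only [one_mul, one_pow, Finset.sum_const, Finset.card_univ, nsmul_eq_mul, mul_one,
      card_outcome, Real.sq_sqrt (hsSq_nonneg _)] using this
  have hsum : ∑ ω, hsSq (Y ω) ≤ n * ((∏ i, (L i : ℝ)) * (∏ i, (K i : ℝ)) ^ 2 *
      ∑ T ∈ Finset.univ.filter (fun T : Finset (Fin m) => T.Nonempty),
        (∏ i ∈ T, ((L i : ℝ) / K i)) *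
          2 ^ (-minEntropy (reducedTR (pureState ψ) T) (reducedR (pureState ψ)))) := by
    rw [hY, sum_hsSq_outcomeMat_sub, Finset.mul_sum _ _ ((∏ i, (L i : ℝ)) * _)]
    refine mul_le_mul_of_nonneg_left (Finset.sum_le_sum fun T _ => ?_) hn.le
    rw [weight_div hK, mul_assoc]
    refine mul_le_mul_of_nonneg_left (mul_le_mul_of_nonneg_left ?_ ?_) (by positivity)
    · exact minEntropy_bound ψ hψ T (hpur T)
    · exact Finset.prod_nonneg fun i _ => by positivity
  set q := ∑ T ∈ Finset.univ.filter (fun T : Finset (Fin m) => T.Nonempty),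
        (∏ i ∈ T, ((L i : ℝ) / K i)) *
          2 ^ (-minEntropy (reducedTR (pureState ψ) T) (reducedR (pureState ψ))) with hq
  calc (n * (∏ i, (L i : ℝ)) * ∏ i, (K i : ℝ))⁻¹ * √(∏ i, (L i : ℝ)) * ∑ ω, √(hsSq (Y ω))
      ≤ (n * (∏ i, (L i : ℝ)) * ∏ i, (K i : ℝ))⁻¹ * √(∏ i, (L i : ℝ)) *
        (√n * √(n * ((∏ i, (L i : ℝ)) * (∏ i, (K i : ℝ)) ^ 2 * q))) :=
        mul_le_mul_of_nonneg_left (hcs.trans (mul_le_mul_of_nonneg_left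
          (Real.sqrt_le_sqrt hsum) (Real.sqrt_nonneg _))) (by positivity)
    _ = √q := by
        rw [Real.sqrt_mul hn.le, mul_assoc (∏ i, (L i : ℝ)), Real.sqrt_mul hLp.le,
          Real.sqrt_mul (by positivity), Real.sqrt_sq hKp.le]
        calc (n * (∏ i, (L i : ℝ)) * ∏ i, (K i : ℝ))⁻¹ * √(∏ i, (L i : ℝ)) *
            (√n * (√n * (√(∏ i, (L i : ℝ)) * ((∏ i, (K i : ℝ)) * √q))))
            = (n * (∏ i, (L i : ℝ)) * ∏ i, (K i : ℝ))⁻¹ * ((√n * √n) *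
              (√(∏ i, (L i : ℝ)) * √(∏ i, (L i : ℝ))) * ∏ i, (K i : ℝ)) * √q := by ring
          _ = √q := by
            rw [Real.mul_self_sqrt hn.le, Real.mul_self_sqrt hLp.le,
              inv_mul_cancel₀ (by positivity), one_mul]

end Decoders

/-! ### State vectors as matrices, and the senders' Kraus operators. -/

section Amplitudes

variable {a b c : Type*}

/-- A vector on `(S ⊗ Z) ⊗ R` from its matrix from `Z` to `S ⊗ R`. -/
def vecOfMat (F : Matrix (a × c) b ℂ) : (a × b) × c → ℂ := fun p => F (p.1.1, p.2) p.1.2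

theorem vecSq_vecOfMat [Fintype a] [Fintype b] [Fintype c] (F : Matrix (a × c) b ℂ) :
    vecSq (vecOfMat F) = hsSq F := by
  simp only [vecSq, hsSq, vecOfMat, Fintype.sum_prod_type]
  refine Finset.sum_congr rfl fun x _ => ?_
  rw [Finset.sum_comm]

theorem hsSq_mul_transpose [Fintype a] [Fintype b] [Fintype c] (M : Matrix a b ℂ)
    (W : Matrix c b ℂ) : hsSq (M * Wᵀ) = (Mᵀ * Mᵀᴴ * (Wᴴ * W)).trace.re := by
  rw [← hsSq_transpose, transpose_mul, transpose_transpose, hsSq_eq_re_trace, conjTranspose_mul,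
    Matrix.mul_assoc, trace_mul_comm]
  simp only [Matrix.mul_assoc]

/-- Conservation of probability under the receiver's channel. -/
theorem hsSq_mul_transpose_add_sum [Fintype a] [Fintype b] [DecidableEq b] [Fintype c]
    {κ : Type*} [Fintype κ] (M : Matrix a b ℂ) (V : Matrix c b ℂ) (u : κ → Matrix c b ℂ)
    (h : Vᴴ * V + ∑ k, (u k)ᴴ * u k = 1) :
    hsSq (M * Vᵀ) + ∑ k, hsSq (M * (u k)ᵀ) = hsSq M := by
  simp only [hsSq_mul_transpose]
  rw [← Complex.re_sum, ← Complex.add_re, ← trace_sum, ← trace_add, ← Matrix.mul_sum,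
    ← Matrix.mul_add, h, Matrix.mul_one, ← hsSq_eq_re_trace, hsSq_transpose]

theorem pureState_smul (x : ℝ) (v : a → ℂ) :
    pureState ((x : ℂ) • v) = ((x ^ 2 : ℝ) : ℂ) • pureState v := by
  ext i j
  simp [pureState, vecMulVec_apply]
  ring

theorem mul_pureState_mul [Fintype a] (A : Matrix b a ℂ) (v : a → ℂ) :
    A * pureState v * Aᴴ = pureState (A *ᵥ v) := by
  rw [pureState, pureState, mul_vecMulVec, vecMulVec_mul, star_mulVec]

variable {m : ℕ} {C : Fin m → Type*} {B R : Type*} {K L : Fin m → ℕ}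

theorem prod_maxEnt (K : Fin m → ℕ) (x y : ∀ i, Fin (K i)) :
    ∏ i, maxEnt (K i) (x i) (y i) =
      (((√(∏ i, (K i : ℝ)))⁻¹ : ℝ) : ℂ) * if x = y then 1 else 0 := by
  classical
  unfold maxEnt
  rw [Finset.prod_ite_zero]
  by_cases h : x = y
  · subst h
    simp only [implies_true, if_true, mul_one]
    rw [Real.sqrt_prod _ (fun i _ => by positivity), ← Finset.prod_inv_distrib]
    push_cast
    simp
  · rw [if_neg h, if_neg (fun h' => h (funext fun i => h' i (Finset.mem_univ i))), mul_zero]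

/-- The target state as a matrix from the receiver to `C¹_M R`. -/
noncomputable def targetMat (L : Fin m → ℕ) (ψ : (∀ i, C i) × B × R → ℂ) :
    Matrix (SenderOut L × R) (ReceiverOut C B L) ℂ :=
  Matrix.of fun x y => ψ (y.2.1, y.2.2, x.2) * ∏ i, maxEnt (L i) (x.1 i) (y.1 i)

variable [∀ i, Fintype (C i)] [Fintype B]

theorem targetMat_mul_conjTranspose (ψ : (∀ i, C i) × B × R → ℂ) :
    targetMat L ψ * (targetMat L ψ)ᴴ =
      (∏ i, (L i : ℂ))⁻¹ • ((1 : Matrix (SenderOut L) (SenderOut L) ℂ) ⊗ₖ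
        reducedR (pureState ψ)) := by
  ext ⟨x, r⟩ ⟨x', r'⟩
  have hq : ((((√(∏ i, (L i : ℝ)))⁻¹ : ℝ) : ℂ)) * (((√(∏ i, (L i : ℝ)))⁻¹ : ℝ) : ℂ) =
      (∏ i, (L i : ℂ))⁻¹ := by
    rw [← Complex.ofReal_mul, ← mul_inv, Real.mul_self_sqrt (Finset.prod_nonneg fun i _ => by
      positivity)]
    push_cast
    rfl
  simp only [Matrix.mul_apply, targetMat, prod_maxEnt, Matrix.of_apply, conjTranspose_apply,
    Fintype.sum_prod_type, Matrix.smul_apply, kroneckerMap_apply, Matrix.one_apply, smul_eq_mul,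
    reducedR_pureState_apply, blockCM, ← hq]
  rw [Finset.sum_eq_single x (fun x' _ h => by simp [Ne.symm h]) (by simp)]
  by_cases h : x = x'
  · subst h
    simp only [if_true, mul_one, one_mul, Finset.mul_sum]
    refine Finset.sum_congr rfl fun y _ => Finset.sum_congr rfl fun b _ => ?_
    rw [star_mul']
    simp only [Complex.star_def, Complex.conj_ofReal]
    ring
  · simp [h, Ne.symm h]

theorem hsSq_targetMat [Fintype R] (hL : ∀ i, 1 ≤ L i) (ψ : (∀ i, C i) × B × R → ℂ)
    (hψ : vecSq ψ = 1) : hsSq (targetMat L ψ) = 1 := by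
  have hLp := prod_natCast_pos hL
  have h2 : (∏ i, (L i : ℂ)) ≠ 0 := by exact_mod_cast hLp.ne'
  rw [hsSq_eq_re_trace, targetMat_mul_conjTranspose, trace_smul, trace_kronecker, trace_reducedR,
    hψ, trace_one, Fintype.card_pi]
  simp [h2]

/-- Pairs of functions and functions to pairs. -/
def piProdEquiv {ι : Type*} (α β : ι → Type*) : (∀ i, α i × β i) ≃ (∀ i, α i) × (∀ i, β i) where
  toFun f := (fun i => (f i).1, fun i => (f i).2)
  invFun p := fun i => (p.1 i, p.2 i)
  left_inv _ := rfl
  right_inv _ := rfl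

/-- Kraus operators of the random measurement of one sender. -/
noncomputable def sampleKraus (i : Fin m) (f : Outcome C K L i) :
    Matrix (Fin (L i)) (C i × Fin (K i)) ℂ :=
  Matrix.of fun x y =>
    (((√((8 : ℝ) ^ Fintype.card (Fin (L i) × (C i × Fin (K i))) * L i))⁻¹ : ℝ) : ℂ) *
      sample (f (x, y))

/-- Different columns are uncorrelated, and each consists of L_i entries of total second moment 8^N;
this fixes the normalization of `sampleKraus`. -/
theorem sum_sampleKraus [∀ i, DecidableEq (C i)] (i : Fin m) (hL : 1 ≤ L i) :
    ∑ f : Outcome C K L i, (sampleKraus i f)ᴴ * sampleKraus i f = 1 := by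
  set N : ℕ := Fintype.card (Fin (L i) × (C i × Fin (K i))) with hN
  have hLp : (0 : ℝ) < L i := by exact_mod_cast hL
  have hq : (((√((8 : ℝ) ^ N * L i))⁻¹ : ℝ) : ℂ) * (((√((8 : ℝ) ^ N * L i))⁻¹ : ℝ) : ℂ) =
      ((8 : ℂ) ^ N * L i)⁻¹ := by
    rw [← Complex.ofReal_mul, ← mul_inv, Real.mul_self_sqrt (by positivity)]
    push_cast
    rfl
  ext y y'
  simp only [Matrix.sum_apply, Matrix.mul_apply, conjTranspose_apply, sampleKraus,
    Matrix.of_apply, ← hN]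
  have e : ∀ (f : Outcome C K L i) (x : Fin (L i)),
      star ((((√((8 : ℝ) ^ N * L i))⁻¹ : ℝ) : ℂ) * sample (f (x, y))) *
        ((((√((8 : ℝ) ^ N * L i))⁻¹ : ℝ) : ℂ) * sample (f (x, y'))) =
      ((8 : ℂ) ^ N * L i)⁻¹ * (sample (f (x, y')) * star (sample (f (x, y)))) := by
    intro f x
    rw [← hq, star_mul']
    simp only [Complex.star_def, Complex.conj_ofReal]
    ring
  simp only [e, ← Finset.mul_sum]
  rw [Finset.sum_comm]
  simp only [sum_sample_two, Prod.mk.injEq, true_and, Finset.sum_const, Finset.card_univ,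
    Fintype.card_fin, nsmul_eq_mul, Matrix.one_apply, ← hN]
  have h2 : (L i : ℂ) ≠ 0 := by exact_mod_cast hLp.ne'
  simp only [eq_comm (a := y')]
  rw [← mul_assoc, ← mul_assoc, mul_assoc (_)⁻¹, mul_comm (L i : ℂ),
    inv_mul_cancel₀ (by positivity), one_mul]

theorem tensorPi_sampleKraus (ω : ∀ i, Outcome C K L i) (x : SenderOut L) (q : SenderIn C K) :
    tensorPi (fun i => sampleKraus i (ω i)) x q =
      (((√(outcomeCard C K L * ∏ i, (L i : ℝ)))⁻¹ : ℝ) : ℂ) *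
        ∏ i, sample (ω i (x i, q i)) := by
  simp only [tensorPi, sampleKraus, Matrix.of_apply, Finset.prod_mul_distrib]
  congr 1
  rw [outcomeCard, ← Finset.prod_mul_distrib, Real.sqrt_prod _ (fun i _ => by positivity),
    ← Finset.prod_inv_distrib]
  push_cast
  rfl

variable [Fintype R] [DecidableEq R]

/-- The vector produced by one Kraus operator of the protocol. -/
theorem kraus_mulVec_initialVec (ω : ∀ i, Outcome C K L i)
    (W : Matrix (ReceiverOut C B L) (ReceiverIn B K) ℂ) (ψ : (∀ i, C i) × B × R → ℂ) :
    ((tensorPi (fun i => sampleKraus i (ω i)) ⊗ₖ W) ⊗ₖ (1 : Matrix R R ℂ)) *ᵥ initialVec K ψ =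
      vecOfMat (((outcomeNorm C K L : ℂ) • outcomeMat ω ψ) * Wᵀ) := by
  ext ⟨⟨x, z⟩, r⟩
  have hn : (0 : ℝ) ≤ outcomeCard C K L * ∏ i, (L i : ℝ) :=
    mul_nonneg outcomeCard_pos.le (Finset.prod_nonneg fun i _ => by positivity)
  have hnorm : (outcomeNorm C K L : ℂ) = (((√(outcomeCard C K L * ∏ i, (L i : ℝ)))⁻¹ : ℝ) : ℂ) *
      (((√(∏ i, (K i : ℝ)))⁻¹ : ℝ) : ℂ) := by
    rw [outcomeNorm, Real.sqrt_mul hn, mul_inv]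
    push_cast
    rfl
  have hq : ∀ y : ReceiverIn B K, ∑ q : SenderIn C K,
      tensorPi (fun i => sampleKraus i (ω i)) x q * initialVec K ψ ((q, y), r) =
      (outcomeNorm C K L : ℂ) * outcomeMat ω ψ (x, r) y := by
    rintro ⟨b, k⟩
    rw [← Equiv.sum_comp (piProdEquiv C (fun i => Fin (K i))).symm, Fintype.sum_prod_type]
    simp only [tensorPi_sampleKraus, initialVec, prod_maxEnt, outcomeMat, Matrix.of_apply,
      hnorm, Finset.mul_sum]
    refine Finset.sum_congr rfl fun y _ => ?_
    rw [Finset.sum_eq_single k]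
    · simp only [piProdEquiv, Equiv.coe_fn_symm_mk, if_true]
      ring
    · intro k' _ h
      simp [piProdEquiv, h]
    · simp
  simp only [mulVec, dotProduct, vecOfMat, Matrix.mul_apply, Matrix.smul_apply,
    transpose_apply, smul_eq_mul, ← hq, kroneckerMap_apply, Matrix.one_apply]
  rw [Fintype.sum_prod_type, Fintype.sum_prod_type, Finset.sum_comm]
  refine Finset.sum_congr rfl fun y _ => ?_
  rw [Finset.sum_mul]
  refine Finset.sum_congr rfl fun q _ => ?_
  rw [Finset.sum_eq_single r (fun r' _ h => by simp [Ne.symm h]) (by simp)]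
  simp only [if_true]
  ring

end Amplitudes

/-! ### The protocol and its error. -/

section Protocol

variable {m : ℕ} {C : Fin m → Type*} {B R : Type*} {K L : Fin m → ℕ}
  [∀ i, Fintype (C i)] [∀ i, DecidableEq (C i)] [Fintype B] [DecidableEq B]

/-- The instrument of one sender: a random matrix with independent entries. -/
noncomputable def sampleInstrument (i : Fin m) (hL : 1 ≤ L i) :
    Instrument (C i × Fin (K i)) (Fin (L i)) where
  outcomes := Fintype.card (Outcome C K L i)
  krausNum := 1
  kraus j _ := sampleKraus i ((Fintype.equivFin (Outcome C K L i)).symm j)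
  complete := by
    simp only [Finset.univ_unique, Finset.sum_singleton]
    rw [Equiv.sum_comp (Fintype.equivFin (Outcome C K L i)).symm
      (fun f => (sampleKraus i f).conjTranspose * sampleKraus i f)]
    exact sum_sampleKraus i hL

/-- A channel with a distinguished first Kraus operator. -/
def consChannel {y z : Type*} [Fintype y] [DecidableEq y] [Fintype z] {n : ℕ}
    (V : Matrix z y ℂ) (u : Fin n → Matrix z y ℂ) (h : Vᴴ * V + ∑ k, (u k)ᴴ * u k = 1) :
    Channel y z where
  krausNum := n + 1
  kraus := Fin.cons V u
  complete := by
    rw [Fin.sum_univ_succ]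
    simpa using h

/-- Labels of the joint outcomes. -/
noncomputable def outcomeEquiv (C : Fin m → Type*) (K L : Fin m → ℕ) [∀ i, Fintype (C i)]
    [∀ i, DecidableEq (C i)] :
    (∀ i, Fin (Fintype.card (Outcome C K L i))) ≃ (∀ i, Outcome C K L i) :=
  Equiv.piCongrRight fun i => (Fintype.equivFin (Outcome C K L i)).symm

/-- The protocol in which the senders apply random instruments. -/
noncomputable def sampleProtocol (hL : ∀ i, 1 ≤ L i) {n : ℕ}
    (V : (∀ i, Outcome C K L i) → Matrix (ReceiverOut C B L) (ReceiverIn B K) ℂ)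
    (u : (∀ i, Outcome C K L i) → Fin n → Matrix (ReceiverOut C B L) (ReceiverIn B K) ℂ)
    (h : ∀ ω, (V ω)ᴴ * V ω + ∑ k, (u ω k)ᴴ * u ω k = 1) : Protocol C B K L where
  sender i := sampleInstrument i (hL i)
  decoder J := consChannel (V (outcomeEquiv C K L J)) (u (outcomeEquiv C K L J)) (h _)

variable [Fintype R] [DecidableEq R]

theorem sampleProtocol_apply (hL : ∀ i, 1 ≤ L i) {n : ℕ}
    (V : (∀ i, Outcome C K L i) → Matrix (ReceiverOut C B L) (ReceiverIn B K) ℂ)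
    (u : (∀ i, Outcome C K L i) → Fin n → Matrix (ReceiverOut C B L) (ReceiverIn B K) ℂ)
    (h : ∀ ω, (V ω)ᴴ * V ω + ∑ k, (u ω k)ᴴ * u ω k = 1) (ψ : (∀ i, C i) × B × R → ℂ) :
    (sampleProtocol hL V u h).apply (pureState (initialVec K ψ)) =
      ∑ ω, (pureState (vecOfMat (((outcomeNorm C K L : ℂ) • outcomeMat ω ψ) * (V ω)ᵀ)) +
        ∑ k, pureState (vecOfMat (((outcomeNorm C K L : ℂ) • outcomeMat ω ψ) * (u ω k)ᵀ))) := by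
  rw [← Equiv.sum_comp (outcomeEquiv C K L)]
  unfold Protocol.apply
  refine Finset.sum_congr rfl fun J _ => ?_
  have : Unique (∀ i, Fin ((sampleProtocol hL V u h).sender i).krausNum) :=
    inferInstanceAs (Unique (∀ _ : Fin m, Fin 1))
  rw [Fintype.sum_unique]
  simp only [mul_pureState_mul]
  refine (Fin.sum_univ_succ (n := n) _).trans ?_
  simp only [← kraus_mulVec_initialVec]
  rfl

theorem exists_protocol (ψ : (∀ i, C i) × B × R → ℂ) (hψ : vecSq ψ = 1)
    (hK : ∀ i, 1 ≤ K i) (hL : ∀ i, 1 ≤ L i) :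
    ∃ P : Protocol C B K L, P.Merges ψ
      (3 * √√(∑ T ∈ Finset.univ.filter (fun T : Finset (Fin m) => T.Nonempty),
        (∏ i ∈ T, ((L i : ℝ) / K i)) *
          2 ^ (-minEntropy (reducedTR (pureState ψ) T) (reducedR (pureState ψ))))) := by
  -- A unit vector forces the systems to be nonempty, and 1 ≤ L_i supplies the remaining index; the
  -- completion needs a fixed output state.
  have hne : Nonempty (ReceiverOut C B L) := by
    have : Nonempty ((∀ i, C i) × B × R) := by
      by_contra hcon
      rw [not_nonempty_iff] at hcon
      simp [vecSq] at hψ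
    obtain ⟨y, b, r⟩ := this
    exact ⟨(fun i => ⟨0, hL i⟩, y, b)⟩
  obtain ⟨V, hV, hsum⟩ := exists_decoders ψ hψ hK hL (targetMat L ψ)
    (targetMat_mul_conjTranspose ψ)
  choose u hu using fun ω => exists_kraus_completion (V ω) (hV ω)
  refine ⟨sampleProtocol hL V u hu, ?_⟩
  have hn := outcomeCard_pos (C := C) (K := K) (L := L)
  -- The target is cut into equal shares, one per outcome, so that it can be compared with the
  -- protocol's output outcome by outcome.
  have htarget : pureState (targetVec L ψ) = ∑ _ω : ∀ i, Outcome C K L i,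
      pureState (vecOfMat ((targetNorm C K L : ℂ) • targetMat L ψ)) := by
    have : vecOfMat ((targetNorm C K L : ℂ) • targetMat L ψ) =
        (targetNorm C K L : ℂ) • targetVec L ψ := rfl
    rw [this, pureState_smul, targetNorm_sq, Finset.sum_const, Finset.card_univ,
      ← Nat.cast_smul_eq_nsmul ℂ, smul_smul, ← card_outcome]
    have h0 : (Fintype.card (∀ i, Outcome C K L i) : ℂ) ≠ 0 := by
      have := hn.ne'
      rw [← card_outcome] at this
      exact_mod_cast this
    push_cast
    rw [mul_inv_cancel₀ h0, one_smul]
  unfold Protocol.Merges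
  classical
  rw [sampleProtocol_apply, htarget, ← Finset.sum_sub_distrib]
  -- `p` is the outcome's probability. By conservation of probability, `d` is exactly the squared
  -- distance from the decoded vector to its share of the target plus the weight of the other Kraus
  -- operators.
  refine (traceNorm_sum_le
    (fun ω => vecOfMat (((outcomeNorm C K L : ℂ) • outcomeMat ω ψ) * (V ω)ᵀ))
    (fun _ => vecOfMat ((targetNorm C K L : ℂ) • targetMat L ψ))
    (fun ω k => vecOfMat (((outcomeNorm C K L : ℂ) • outcomeMat ω ψ) * (u ω k)ᵀ))
    (fun ω => hsSq ((outcomeNorm C K L : ℂ) • outcomeMat ω ψ) +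
        hsSq ((targetNorm C K L : ℂ) • targetMat L ψ) -
        2 * (((outcomeNorm C K L : ℂ) • outcomeMat ω ψ) * (V ω)ᵀ *
          ((targetNorm C K L : ℂ) • targetMat L ψ)ᴴ).trace.re)
    (fun ω => hsSq ((outcomeNorm C K L : ℂ) • outcomeMat ω ψ)) ?_ ?_ ?_ ?_).trans ?_
  · intro ω
    have e : vecOfMat (((outcomeNorm C K L : ℂ) • outcomeMat ω ψ) * (V ω)ᵀ) -
        vecOfMat ((targetNorm C K L : ℂ) • targetMat L ψ) =
        vecOfMat (((outcomeNorm C K L : ℂ) • outcomeMat ω ψ) * (V ω)ᵀ -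
          (targetNorm C K L : ℂ) • targetMat L ψ) := rfl
    simp only [e, vecSq_vecOfMat, hsSq_sub]
    have := hsSq_mul_transpose_add_sum ((outcomeNorm C K L : ℂ) • outcomeMat ω ψ) (V ω) (u ω)
      (hu ω)
    linarith
  · intro ω
    simp only [vecSq_vecOfMat]
    exact (hsSq_mul_transpose_add_sum _ (V ω) (u ω) (hu ω)).le
  · exact (sum_hsSq_outcomeMat ψ hψ hK hL).le
  · simp only [vecSq_vecOfMat, hsSq_smul, hsSq_targetMat hL ψ hψ, targetNorm_sq, mul_one,
      Finset.sum_const, Finset.card_univ, nsmul_eq_mul, card_outcome]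
    rw [mul_inv_cancel₀ hn.ne']
  · exact mul_le_mul_of_nonneg_left (Real.sqrt_le_sqrt hsum) (by norm_num)

end Protocol

end MultipartyMerging

/-! ### From the cost condition to the error ε. -/

theorem term_le_of_cost {m : ℕ} {K L : Fin m → ℕ} (hK : ∀ i, 1 ≤ K i) (hL : ∀ i, 1 ≤ L i)
    {ε h : ℝ} (hε : 0 < ε) (T : Finset (Fin m))
    (hcost : ∑ i ∈ T, Real.logb 2 ((K i : ℝ) / (L i : ℝ)) ≥
      -h + 4 * Real.logb 2 (1 / ε) + 2 * (m : ℝ) + 8) :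
    (∏ i ∈ T, ((L i : ℝ) / K i)) * 2 ^ (-h) ≤ ε ^ 4 / 256 / 2 ^ m := by
  have hK' : ∀ i, (0 : ℝ) < K i := fun i => by exact_mod_cast hK i
  have hL' : ∀ i, (0 : ℝ) < L i := fun i => by exact_mod_cast hL i
  have h1 : ∏ i ∈ T, ((L i : ℝ) / K i) = 2 ^ (-∑ i ∈ T, Real.logb 2 ((K i : ℝ) / (L i : ℝ))) := by
    rw [← Real.logb_prod _ _ fun i _ => (div_pos (hK' i) (hL' i)).ne', Real.rpow_neg (by norm_num),
      Real.rpow_logb (by norm_num) (by norm_num)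
        (Finset.prod_pos fun i _ => div_pos (hK' i) (hL' i)), ← Finset.prod_inv_distrib]
    exact Finset.prod_congr rfl fun i _ => (inv_div _ _).symm
  have h2 : ε ^ 4 / 256 / 2 ^ m = 2 ^ (4 * Real.logb 2 ε - 8 - m) := by
    rw [Real.rpow_sub (by norm_num), Real.rpow_sub (by norm_num), mul_comm (4 : ℝ),
      Real.rpow_mul (by norm_num), Real.rpow_logb (by norm_num) (by norm_num) hε]
    norm_num
  rw [h1, h2, ← Real.rpow_add (by norm_num)]
  refine Real.rpow_le_rpow_of_exponent_le (by norm_num) ?_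
  have h3 : Real.logb 2 (1 / ε) = -Real.logb 2 ε := by rw [one_div, Real.logb_inv]
  -- Of the 2m in the hypothesis only m is used, to pay for the at most 2^m subsets.
  have h4 : (0 : ℝ) ≤ m := by positivity
  rw [h3] at hcost
  linarith

theorem mainTheorem7 {m : ℕ} {C : Fin m → Type*} {B R : Type*}
    [∀ i, Fintype (C i)] [∀ i, DecidableEq (C i)] [Fintype B] [DecidableEq B]
    [Fintype R] [DecidableEq R]
    (ψ : EuclideanSpace ℂ ((∀ i, C i) × B × R)) (hψ : ‖ψ‖ = 1)
    (K L : Fin m → ℕ) (hK : ∀ i, 1 ≤ K i) (hL : ∀ i, 1 ≤ L i)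
    (ε : ℝ) (hε : 0 < ε)
    (hcost : ∀ T : Finset (Fin m), T.Nonempty →
      ∑ i ∈ T, Real.logb 2 ((K i : ℝ) / (L i : ℝ)) ≥
        -MultipartyMerging.minEntropy
            (MultipartyMerging.reducedTR (MultipartyMerging.pureState ψ) T)
            (MultipartyMerging.reducedR (MultipartyMerging.pureState ψ))
          + 4 * Real.logb 2 (1 / ε) + 2 * (m : ℝ) + 8) :
    ∃ P : MultipartyMerging.Protocol C B K L, P.Merges ψ ε := by
  have hψ1 : MultipartyMerging.vecSq ψ = 1 := by
    have := EuclideanSpace.norm_sq_eq ψ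
    rw [hψ] at this
    rw [MultipartyMerging.vecSq, ← this]
    norm_num
  obtain ⟨P, hP⟩ := MultipartyMerging.exists_protocol ψ hψ1 hK hL
  refine ⟨P, ?_⟩
  unfold MultipartyMerging.Protocol.Merges at hP ⊢
  refine hP.trans ?_
  have h1 := Finset.sum_le_sum fun (T : Finset (Fin m))
    (hT : T ∈ Finset.univ.filter (fun T : Finset (Fin m) => T.Nonempty)) =>
    term_le_of_cost hK hL hε T (hcost T (Finset.mem_filter.1 hT).2)
  have h2 : ∑ T ∈ Finset.univ.filter (fun T : Finset (Fin m) => T.Nonempty),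
      ε ^ 4 / 256 / 2 ^ m ≤ (ε ^ 2 / 16) ^ 2 := by
    rw [Finset.sum_const, nsmul_eq_mul]
    have h3 : ((Finset.univ.filter (fun T : Finset (Fin m) => T.Nonempty)).card : ℝ) ≤ 2 ^ m := by
      have := Finset.card_filter_le (Finset.univ : Finset (Finset (Fin m))) (fun T => T.Nonempty)
      rw [Finset.card_univ, Fintype.card_finset, Fintype.card_fin] at this
      exact_mod_cast this
    calc _ ≤ (2 : ℝ) ^ m * (ε ^ 4 / 256 / 2 ^ m) :=
          mul_le_mul_of_nonneg_right h3 (by positivity)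
      _ = (ε ^ 2 / 16) ^ 2 := by field_simp; norm_num
  -- As 256 = 4⁴, the fourth root is at most ε/4, and the prefactor 3 leaves 3ε/4 ≤ ε.
  have h4 := Real.sqrt_le_sqrt (Real.sqrt_le_sqrt (h1.trans h2))
  rw [Real.sqrt_sq (by positivity), show ε ^ 2 / 16 = (ε / 4) ^ 2 by ring,
    Real.sqrt_sq (by positivity)] at h4
  linarith
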